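/- Let $\Omega=\{(x,y)\in\mathbb R^2 : r^2=x^2+y^2<1\}$ and, for $\beta\ge 0$, let $(f,g)_\beta=\int_\Omega (1-r^2)^\beta f g\,dx\,dy$, $\|f\|_\beta=(f,f)_\beta^{1/2}$, and let $L^2_\beta(\Omega)$ be the corresponding weighted space of real functions. For $\gamma\ge 0$ and an integer $s\ge 0$ let $H^s_\gamma(\Omega)$ be the space of all $u\in L^2_\gamma(\Omega)$ whose weak derivatives of order $s$ on $\Omega$ exist and lie in $L^2_{\gamma+s}(\Omega)$, with the seminorm $$|u|_{H^s_\gamma}=\Big(\sum_{j=0}^s\binom sj\Big\|\frac{\partial^s u}{\partial y^j\,\partial x^{s-j}}\Big\|_{\gamma+s}^2\Big)^{1/2}.$$ In polar coordinates $(r,\varphi)$ let $\mathcal V_{0,1}=\tfrac12$, $\mathcal V_{l,1}=r^l\cos(l\varphi)$ and $\mathcal V_{l,-1}=r^l\sin(l\varphi)$ for $l\ge1$. Let $P_n^{(\gamma,l)}$ be the Jacobi polynomials, $\rho=2r^2-1$, and let $$a_{l,n,\mu}=\frac{(u,\ \mathcal V_{l,\mu}P_n^{(\gamma,l)}(\rho))_\gamma}{\|\mathcal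 V_{l,\mu}P_n^{(\gamma,l)}(\rho)\|_\gamma^2}$$ be the coefficients of $u$ with respect to the orthogonal basis $\{\mathcal V_{l,\mu}P_n^{(\gamma,l)}(\rho)\}$ of $L^2_\gamma(\Omega)$, where $l,n\ge0$ and $\mu\in\{1,-1\}$, with $(l,\mu)=(0,-1)$ omitted. Then for every real $\gamma\ge0$ and every integer $s\ge 0$ there are constants $C_0,C_1>0$, depending only on $\gamma$ and $s$, such that for every $u\in H^s_\gamma(\Omega)$ the series $$S(u)=\sum_{2n+l\ge s,\ \mu}(n+1)^s(n+l+1)^s\,a_{l,n,\mu}^2\,\big\|\mathcal V_{l,\mu}P_n^{(\gamma,l)}(\rho)\big\|_\gamma^2$$ converges and $$C_0\,S(u)\le |u|_{H^s_\gamma}^2\le C_1\,S(u).$$ -/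

import Mathlib

open MeasureTheory
open scoped ContDiff

namespace WeightedDisk

noncomputable section

/-- The open unit disk `Ω` in the plane. -/
def disk : Set (ℝ × ℝ) := {p | p.1 ^ 2 + p.2 ^ 2 < 1}

/-- The measure `(1 - r²)^γ dx dy` on the unit disk. -/
def diskMeasure (γ : ℝ) : Measure (ℝ × ℝ) :=
  (volume.restrict disk).withDensity
    (fun p => ENNReal.ofReal ((1 - (p.1 ^ 2 + p.2 ^ 2)) ^ γ))

/-- Membership in `L²_γ(Ω)`. -/
def MemL2 (γ : ℝ) (f : ℝ × ℝ → ℝ) : Prop := MemLp f 2 (diskMeasure γ)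

/-- The inner product `(f, g)_γ = ∫_Ω (1 - r²)^γ f g`. -/
def wInner (γ : ℝ) (f g : ℝ × ℝ → ℝ) : ℝ := ∫ p, f p * g p ∂(diskMeasure γ)

/-- The norm `‖f‖_γ = (f, f)_γ^{1/2}` of `L²_γ(Ω)`. -/
def wNorm (γ : ℝ) (f : ℝ × ℝ → ℝ) : ℝ := √(wInner γ f f)

/-- The classical partial derivative `∂/∂x`. -/
def partialX (φ : ℝ × ℝ → ℝ) : ℝ × ℝ → ℝ := fun p => fderiv ℝ φ p (1, 0)

/-- The classical partial derivative `∂/∂y`. -/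
def partialY (φ : ℝ × ℝ → ℝ) : ℝ × ℝ → ℝ := fun p => fderiv ℝ φ p (0, 1)

/-- `v` is a weak derivative `∂^{i+j} u / ∂y^j ∂x^i` of `u` on the unit disk. -/
def IsWeakDeriv (i j : ℕ) (u v : ℝ × ℝ → ℝ) : Prop :=
  LocallyIntegrableOn u disk ∧ LocallyIntegrableOn v disk ∧
    ∀ φ : ℝ × ℝ → ℝ, ContDiff ℝ ∞ φ → HasCompactSupport φ → tsupport φ ⊆ disk →
      ∫ p in disk, u p * (partialX^[i] (partialY^[j] φ)) p
        = (-1) ^ (i + j) * ∫ p in disk, v p * φ p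

open Classical in
/-- The weak derivative `∂^{i+j} u / ∂y^j ∂x^i` on the unit disk. It is determined almost everywhere
on the disk when it exists, and is `0` by convention when it does not exist. -/
def weakDeriv (i j : ℕ) (u : ℝ × ℝ → ℝ) : ℝ × ℝ → ℝ :=
  if h : ∃ v, IsWeakDeriv i j u v then h.choose else 0

/-- Membership in the weighted Sobolev space `H^s_γ(Ω)`: `u` lies in `L²_γ(Ω)` and its weak
derivatives of order exactly `s` exist and lie in `L²_{γ+s}(Ω)`. -/
def MemSobolev (γ : ℝ) (s : ℕ) (u : ℝ × ℝ → ℝ) : Prop :=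
  MemL2 γ u ∧
    ∀ j ≤ s, ∃ v, IsWeakDeriv (s - j) j u v ∧ MemL2 (γ + s) v

/-- The seminorm `|u|_{H^s_γ}`. -/
def sobolevSeminorm (γ : ℝ) (s : ℕ) (u : ℝ × ℝ → ℝ) : ℝ :=
  √(∑ j ∈ Finset.range (s + 1),
      (s.choose j : ℝ) * wNorm (γ + s) (weakDeriv (s - j) j u) ^ 2)

/-- The Jacobi polynomial `P_n^{(a,b)}(t)`. -/
def jacobiP (n : ℕ) (a b t : ℝ) : ℝ :=
  (-1) ^ n * (Real.Gamma (n + 1 + b) / (n.factorial * Real.Gamma (n + 1 + a + b))) *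
    ∑ j ∈ Finset.range (n + 1),
      (-1) ^ j * (2 ^ j)⁻¹ * (n.choose j : ℝ) *
        (Real.Gamma (n + j + 1 + a + b) / Real.Gamma (j + 1 + b)) * (1 + t) ^ j

/-- The solid harmonic polynomials `V_{0,1} = 1/2`, `V_{l,1} = r^l cos (l φ)` and
`V_{l,-1} = r^l sin (l φ)` for `l ≥ 1`; the latter two are the real and the imaginary part of
`(x + i y)^l`. (The value at `l = 0`, `μ = -1` is `0`.) -/
def solidHarmonic (l : ℕ) (μ : ℤˣ) (p : ℝ × ℝ) : ℝ :=
  if μ = 1 then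
    if l = 0 then 1 / 2 else ((⟨p.1, p.2⟩ : ℂ) ^ l).re
  else ((⟨p.1, p.2⟩ : ℂ) ^ l).im

/-- The indices `(l, n, μ)` of the basis functions, without the indices `(0, n, -1)`. -/
structure BasisIndex where
  l : ℕ
  n : ℕ
  μ : ℤˣ
  zero_imp : l = 0 → μ = 1

/-- The basis function `V_{l,μ}(x) P_n^{(γ,l)}(ρ)`, `ρ = 2 r² - 1`. -/
def basisFun (γ : ℝ) (i : BasisIndex) (p : ℝ × ℝ) : ℝ :=
  solidHarmonic i.l i.μ p * jacobiP i.n γ i.l (2 * (p.1 ^ 2 + p.2 ^ 2) - 1)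

/-- The Fourier-Jacobi coefficient `a_{l,n,μ}` of `u` with respect to the orthogonal basis
of `L²_γ(Ω)`. -/
def coeff (γ : ℝ) (u : ℝ × ℝ → ℝ) (i : BasisIndex) : ℝ :=
  wInner γ u (basisFun γ i) / wNorm γ (basisFun γ i) ^ 2

/-- The summand `(n+1)^s (n+l+1)^s a_{l,n,μ}² ‖V_{l,μ} P_n^{(γ,l)}(ρ)‖_γ²`. -/
def coeffTerm (γ : ℝ) (s : ℕ) (u : ℝ × ℝ → ℝ) (i : BasisIndex) : ℝ :=
  ((i.n : ℝ) + 1) ^ s * ((i.n : ℝ) + i.l + 1) ^ s * coeff γ u i ^ 2 *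
    wNorm γ (basisFun γ i) ^ 2

end

end WeightedDisk

/-!
The proof works with the complex coordinate `z = x + i y`, the weight function `w = 1 - r²` and
the disk polynomials `Z^γ_{p,q}` (`diskPoly`), normalized so that Wirtinger derivatives map disk
polynomials to disk polynomials:

* `∂_z Z^γ_{p+1,q} = Z^{γ+1}_{p,q}`, and likewise for `∂_z̄` (`wirt_diskPoly_succ`);
* `∂_z (w^{γ+1} Z^{γ+1}_{p,q}) = -(p+γ+1)(q+1) w^γ Z^γ_{p,q+1}` (`wirt_wpow_mul_diskPoly`).

The second identity is the adjoint of the first one. Consequently, if `g = ∂_z^a ∂_z̄^b u` weakly and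
`a + b = s`, then the integral of `g Z^{γ+s}_{p,q}` with weight `w^{γ+s}` is an explicit positive
multiple `Λ` (`lam`) of the integral of `u Z^γ_{p+b,q+a}` with weight `w^γ` (`pairing`).
The test functions approximating `w^{γ+s} Z` are
`ε^{γ+s} χ(w/ε) Z`; scaling bounds their derivatives of order `s` by a multiple of `w^γ`, uniformly
in `ε`, so that dominated convergence applies (`tendsto_integral_cutFamilies`) and only the
derivatives of order exactly `s` are needed.

Applied to polynomials, the pairing identity gives the orthogonality of the disk polynomials and the
fact that their squared norms change by the same factor `Λ`. Completeness follows from the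
Stone-Weierstrass theorem, so Parseval's identity holds (`hasSum_parseval`). As the passage from
`∂_x, ∂_y` to `∂_z, ∂_z̄` is unitary up to a constant (`sum_choose_mul_norm_sq`), the squared seminorm
is the sum over all bidegrees `(P, Q)` of

`2^s ∑_{a+b=s} (s choose b) Λ(a, b, P, Q) |∫ u Z_{P,Q}|² / ‖Z_{P,Q}‖²`

(`hasSum_sobolevSeminorm`), and the inner sum of the `Λ` is comparable to `(P+1)^s (Q+1)^s` for
`P + Q ≥ s`, and zero otherwise (`lamSum_le`, `le_lamSum`, `lamSum_eq_zero`). The real basis functions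
are multiples of the real and imaginary parts of the disk polynomials of bidegree `(n+l, n)`
(`exists_basisFun_eq`), so `(P+1)^s (Q+1)^s` is the weight `(n+1)^s (n+l+1)^s`.
-/

namespace WeightedDisk

open Filter Topology

/-! ### Wirtinger derivatives -/

/-- The Wirtinger derivative `(∂/∂x - σ i ∂/∂y) / 2`: it is `∂/∂z` for `σ = 1` and `∂/∂z̄` for
`σ = -1`. -/
noncomputable def wirt (σ : ℂ) (f : ℝ × ℝ → ℂ) : ℝ × ℝ → ℂ :=
  fun x => (fderiv ℝ f x (1, 0) - σ * Complex.I * fderiv ℝ f x (0, 1)) / 2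

/-- The coordinate `x + σ i y`: it is `z` for `σ = 1` and `z̄` for `σ = -1`. -/
noncomputable def zvar (σ : ℂ) (x : ℝ × ℝ) : ℂ := x.1 + σ * Complex.I * x.2

/-- The function `w = 1 - r²`. -/
def bdist (x : ℝ × ℝ) : ℝ := 1 - (x.1 ^ 2 + x.2 ^ 2)

lemma mem_disk_iff {x : ℝ × ℝ} : x ∈ disk ↔ 0 < bdist x := by
  simp [disk, bdist]

lemma bdist_le_one (x : ℝ × ℝ) : bdist x ≤ 1 := by
  unfold bdist; nlinarith [sq_nonneg x.1, sq_nonneg x.2]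

lemma contDiff_bdist : ContDiff ℝ ∞ bdist := by
  unfold bdist; fun_prop

lemma isOpen_disk : IsOpen disk := by
  have : disk = bdist ⁻¹' Set.Ioi 0 := by ext x; simp [mem_disk_iff]
  rw [this]
  exact isOpen_Ioi.preimage contDiff_bdist.continuous

lemma contDiff_zvar (σ : ℂ) : ContDiff ℝ ∞ (zvar σ) := by
  unfold zvar
  have h : ContDiff ℝ ∞ (fun t : ℝ => (t : ℂ)) := Complex.ofRealCLM.contDiff
  exact (h.comp contDiff_fst).add (contDiff_const.mul (h.comp contDiff_snd))

lemma bdist_eq_zvar {σ : ℂ} (hσ : σ ^ 2 = 1) (x : ℝ × ℝ) :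
    (bdist x : ℂ) = 1 - zvar σ x * zvar (-σ) x := by
  simp only [bdist, zvar]
  push_cast
  linear_combination ((x.2 : ℂ) ^ 2) * hσ - σ ^ 2 * (x.2 : ℂ) ^ 2 * Complex.I_sq

lemma contDiff_wirt (σ : ℂ) {f : ℝ × ℝ → ℂ} (hf : ContDiff ℝ ∞ f) :
    ContDiff ℝ ∞ (wirt σ f) := by
  have h : ContDiff ℝ ∞ (fderiv ℝ f) := hf.fderiv_right (by simp)
  unfold wirt
  exact ((h.clm_apply contDiff_const).sub
    (contDiff_const.mul (h.clm_apply contDiff_const))).div_const 2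

lemma contDiff_iterate_wirt (σ : ℂ) (n : ℕ) {f : ℝ × ℝ → ℂ} (hf : ContDiff ℝ ∞ f) :
    ContDiff ℝ ∞ ((wirt σ)^[n] f) := by
  induction n generalizing f with
  | zero => exact hf
  | succ n ih => exact ih (contDiff_wirt σ hf)

section
variable {σ : ℂ} {f g : ℝ × ℝ → ℂ} {x : ℝ × ℝ}

lemma wirt_add (hf : DifferentiableAt ℝ f x) (hg : DifferentiableAt ℝ g x) :
    wirt σ (f + g) x = wirt σ f x + wirt σ g x := by
  simp only [wirt, fderiv_add hf hg, add_apply]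
  ring

lemma wirt_mul (hf : DifferentiableAt ℝ f x) (hg : DifferentiableAt ℝ g x) :
    wirt σ (fun y => f y * g y) x = wirt σ f x * g x + f x * wirt σ g x := by
  have : fderiv ℝ (fun y => f y * g y) x = f x • fderiv ℝ g x + g x • fderiv ℝ f x :=
    fderiv_mul hf hg
  simp only [wirt, this, add_apply, smul_apply, smul_eq_mul]
  ring

lemma wirt_const_mul (c : ℂ) (hf : DifferentiableAt ℝ f x) :
    wirt σ (fun y => c * f y) x = c * wirt σ f x := by
  simp only [wirt, fderiv_const_mul hf, smul_apply, smul_eq_mul]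
  ring

@[simp] lemma wirt_const (c : ℂ) : wirt σ (fun _ => c) x = 0 := by
  simp [wirt]

lemma wirt_sum {ι : Type*} (s : Finset ι) (F : ι → ℝ × ℝ → ℂ)
    (h : ∀ i ∈ s, DifferentiableAt ℝ (F i) x) :
    wirt σ (fun y => ∑ i ∈ s, F i y) x = ∑ i ∈ s, wirt σ (F i) x := by
  simp only [wirt, fderiv_fun_sum h, sum_apply]
  rw [Finset.mul_sum, ← Finset.sum_sub_distrib, Finset.sum_div]

lemma hasFDerivAt_zvar (τ : ℂ) (x : ℝ × ℝ) :
    HasFDerivAt (zvar τ) (Complex.ofRealCLM.comp (ContinuousLinearMap.fst ℝ ℝ ℝ) +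
      (τ * Complex.I) • Complex.ofRealCLM.comp (ContinuousLinearMap.snd ℝ ℝ ℝ)) x :=
  ContinuousLinearMap.hasFDerivAt (Complex.ofRealCLM.comp (ContinuousLinearMap.fst ℝ ℝ ℝ) +
      (τ * Complex.I) • Complex.ofRealCLM.comp (ContinuousLinearMap.snd ℝ ℝ ℝ))

lemma wirt_zvar (σ τ : ℂ) (x : ℝ × ℝ) : wirt σ (zvar τ) x = (1 + σ * τ) / 2 := by
  simp only [wirt, (hasFDerivAt_zvar τ x).fderiv]
  simp
  linear_combination (-σ * τ) * Complex.I_sq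

lemma wirt_zvar_pow (σ τ : ℂ) (n : ℕ) (x : ℝ × ℝ) :
    wirt σ (fun y => zvar τ y ^ n) x = n * zvar τ x ^ (n - 1) * ((1 + σ * τ) / 2) := by
  have hd : DifferentiableAt ℝ (zvar τ) x := (hasFDerivAt_zvar τ x).differentiableAt
  induction n with
  | zero => simp
  | succ n ih =>
    simp only [pow_succ]
    rw [wirt_mul (hd.fun_pow n) hd, ih, wirt_zvar]
    rcases n with _ | n
    · simp
    · simp only [Nat.add_sub_cancel, pow_succ]
      push_cast
      ring

/-- The chain rule `D (G ∘ w) = - G'(w) z̄`. -/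
lemma wirt_comp_bdist {G : ℝ → ℝ} {G' : ℝ} (hG : HasDerivAt G G' (bdist x)) :
    wirt σ (fun y => (G (bdist y) : ℂ)) x = -(G' : ℂ) * zvar (-σ) x := by
  have hb : HasFDerivAt bdist (-((2 * x.1) • ContinuousLinearMap.fst ℝ ℝ ℝ +
      (2 * x.2) • ContinuousLinearMap.snd ℝ ℝ ℝ)) x := by
    have h1 : HasFDerivAt (fun y : ℝ × ℝ => y.1) (ContinuousLinearMap.fst ℝ ℝ ℝ) x :=
      hasFDerivAt_fst
    have h2 : HasFDerivAt (fun y : ℝ × ℝ => y.2) (ContinuousLinearMap.snd ℝ ℝ ℝ) x :=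
      hasFDerivAt_snd
    refine HasFDerivAt.congr_fderiv (((h1.pow 2).add (h2.pow 2)).const_sub 1) ?_
    ext <;> simp
  have h := (Complex.ofRealCLM.hasFDerivAt (x := G (bdist x))).comp x (hG.comp_hasFDerivAt x hb)
  have h' : fderiv ℝ (fun y => (G (bdist y) : ℂ)) x = _ := h.fderiv
  simp only [wirt, h', zvar]
  simp
  ring

end

lemma wirt_congr {σ : ℂ} {f g : ℝ × ℝ → ℂ} {x : ℝ × ℝ} (h : f =ᶠ[nhds x] g) :
    wirt σ f =ᶠ[nhds x] wirt σ g := by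
  filter_upwards [h.fderiv (𝕜 := ℝ)] with y hy
  simp [wirt, hy]

lemma iterate_wirt_congr {σ : ℂ} {f g : ℝ × ℝ → ℂ} {x : ℝ × ℝ} (n : ℕ) (h : f =ᶠ[nhds x] g) :
    (wirt σ)^[n] f =ᶠ[nhds x] (wirt σ)^[n] g := by
  induction n generalizing f g with
  | zero => exact h
  | succ n ih => exact ih (wirt_congr h)

/-! ### Disk polynomials -/

/-- The divided power `z^{p-j} / (p-j)!`, understood as `0` for `j > p`, where `z = zvar σ`. -/
noncomputable def divPow (σ : ℂ) (p j : ℕ) (x : ℝ × ℝ) : ℂ :=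
  if j ≤ p then zvar σ x ^ (p - j) / ((p - j).factorial : ℂ) else 0

lemma contDiff_divPow (σ : ℂ) (p j : ℕ) : ContDiff ℝ ∞ (divPow σ p j) := by
  unfold divPow
  split_ifs
  · exact ((contDiff_zvar σ).pow _).div_const _
  · exact contDiff_const

lemma differentiable_divPow (σ : ℂ) (p j : ℕ) (x : ℝ × ℝ) :
    DifferentiableAt ℝ (divPow σ p j) x :=
  (contDiff_divPow σ p j).differentiable (by simp) x

lemma divPow_of_lt {σ : ℂ} {p j : ℕ} (h : p < j) (x : ℝ × ℝ) : divPow σ p j x = 0 := by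
  simp [divPow, not_le.2 h]

lemma divPow_succ_succ (σ : ℂ) (p j : ℕ) (x : ℝ × ℝ) :
    divPow σ (p + 1) (j + 1) x = divPow σ p j x := by
  simp [divPow]

lemma zvar_mul_divPow_succ (σ : ℂ) (p j : ℕ) (x : ℝ × ℝ) :
    zvar σ x * divPow σ p (j + 1) x = (p - j) * divPow σ p j x := by
  rcases lt_trichotomy j p with h | rfl | h
  · obtain ⟨d, rfl⟩ : ∃ d, p = j + 1 + d := ⟨p - (j + 1), by omega⟩
    have e1 : j + 1 + d - (j + 1) = d := by omega
    have e2 : j + 1 + d - j = d + 1 := by omega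
    have e3 : j + 1 ≤ j + 1 + d := by omega
    have e4 : j ≤ j + 1 + d := by omega
    simp only [divPow, e1, e2, e3, e4, if_true, Nat.factorial_succ, pow_succ]
    have : (d.factorial : ℂ) ≠ 0 := by exact_mod_cast d.factorial_ne_zero
    have : (d : ℂ) + 1 ≠ 0 := by exact_mod_cast d.succ_ne_zero
    push_cast
    field_simp
    ring
  · simp [divPow]
  · simp [divPow_of_lt h, divPow_of_lt (Nat.lt_succ_of_lt h)]

lemma zvar_mul_divPow (σ : ℂ) (p j : ℕ) (x : ℝ × ℝ) :
    zvar σ x * divPow σ p j x = (p + 1 - j) * divPow σ (p + 1) j x := by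
  rw [← divPow_succ_succ, zvar_mul_divPow_succ]
  push_cast
  ring

lemma wirt_divPow_self {σ : ℂ} (hσ : σ ^ 2 = 1) (p j : ℕ) (x : ℝ × ℝ) :
    wirt σ (divPow σ p j) x = divPow σ p (j + 1) x := by
  by_cases h : j ≤ p
  · have e : divPow σ p j = fun y => (1 / ((p - j).factorial : ℂ)) * zvar σ y ^ (p - j) := by
      ext y; simp [divPow, h]; ring
    have hd : DifferentiableAt ℝ (fun y => zvar σ y ^ (p - j)) x :=
      ((contDiff_zvar σ).pow _).differentiable (by simp) x
    rw [e, wirt_const_mul _ hd, wirt_zvar_pow, ← sq, hσ]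
    rcases h.lt_or_eq with h' | rfl
    · obtain ⟨d, rfl⟩ : ∃ d, p = j + 1 + d := ⟨p - (j + 1), by omega⟩
      have e1 : j + 1 + d - (j + 1) = d := by omega
      have e2 : j + 1 + d - j = d + 1 := by omega
      have e3 : j + 1 ≤ j + 1 + d := by omega
      have : (d.factorial : ℂ) ≠ 0 := by exact_mod_cast d.factorial_ne_zero
      have : (d : ℂ) + 1 ≠ 0 := by exact_mod_cast d.succ_ne_zero
      simp only [divPow, e1, e2, e3, if_true, Nat.factorial_succ]
      push_cast
      field_simp
      norm_num
    · simp [divPow]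
  · have e : divPow σ p j = fun _ => 0 := by
      ext y; simp [divPow, h]
    rw [e, wirt_const, divPow_of_lt (by omega)]

lemma wirt_divPow_neg {σ : ℂ} (hσ : σ ^ 2 = 1) (q j : ℕ) (x : ℝ × ℝ) :
    wirt σ (divPow (-σ) q j) x = 0 := by
  by_cases h : j ≤ q
  · have e : divPow (-σ) q j = fun y => (1 / ((q - j).factorial : ℂ)) * zvar (-σ) y ^ (q - j) := by
      ext y; simp [divPow, h]; ring
    have hd : DifferentiableAt ℝ (fun y => zvar (-σ) y ^ (q - j)) x :=
      ((contDiff_zvar (-σ)).pow _).differentiable (by simp) x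
    rw [e, wirt_const_mul _ hd, wirt_zvar_pow, mul_neg, ← sq, hσ]
    simp
  · have e : divPow (-σ) q j = fun _ => 0 := by
      ext y; simp [divPow, h]
    rw [e, wirt_const]

/-- The coefficients `(-1)^j Γ(N + γ + 1 - j) / j!` of the disk polynomials of degree `N`. -/
noncomputable def dpCoeff (γ : ℝ) (N j : ℕ) : ℂ :=
  (((-1) ^ j / j.factorial * Real.Gamma (N + γ + 1 - j) : ℝ) : ℂ)

/-- The disk (Zernike) polynomial
`∑_j (-1)^j Γ(p + q + γ + 1 - j) / (j! (p-j)! (q-j)!) z^{p-j} z̄^{q-j}`, with `z = zvar σ`. This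
normalization makes the Wirtinger derivatives of a disk polynomial again disk polynomials. -/
noncomputable def diskPoly (σ : ℂ) (γ : ℝ) (p q : ℕ) (x : ℝ × ℝ) : ℂ :=
  ∑ j ∈ Finset.range (p + 1), dpCoeff γ (p + q) j * (divPow σ p j x * divPow (-σ) q j x)

lemma diskPoly_eq_sum_range (σ : ℂ) (γ : ℝ) {p q N : ℕ} (hN : p < N ∨ q < N) (x : ℝ × ℝ) :
    diskPoly σ γ p q x =
      ∑ j ∈ Finset.range N, dpCoeff γ (p + q) j * (divPow σ p j x * divPow (-σ) q j x) := by
  have key : ∀ M K : ℕ, M ≤ K → (p < M ∨ q < M) →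
      ∑ j ∈ Finset.range M, dpCoeff γ (p + q) j * (divPow σ p j x * divPow (-σ) q j x) =
      ∑ j ∈ Finset.range K, dpCoeff γ (p + q) j * (divPow σ p j x * divPow (-σ) q j x) := by
    intro M K hMK h
    apply Finset.sum_subset (by simpa using hMK)
    intro j _ hj
    simp only [Finset.mem_range, not_lt] at hj
    rcases h with h | h
    · simp [divPow_of_lt (h.trans_le hj)]
    · simp [divPow_of_lt (h.trans_le hj)]
  unfold diskPoly
  rcases le_total N (p + 1) with h | h
  · exact (key _ _ h hN).symm
  · exact key _ _ h (by simp)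

lemma diskPoly_neg (σ : ℂ) (γ : ℝ) (p q : ℕ) (x : ℝ × ℝ) :
    diskPoly (-σ) γ p q x = diskPoly σ γ q p x := by
  rw [diskPoly_eq_sum_range σ γ (N := p + 1) (by simp)]
  unfold diskPoly
  simp only [neg_neg, add_comm q p, mul_comm]

lemma contDiff_diskPoly (σ : ℂ) (γ : ℝ) (p q : ℕ) : ContDiff ℝ ∞ (diskPoly σ γ p q) := by
  unfold diskPoly
  exact ContDiff.sum fun j _ =>
    contDiff_const.mul ((contDiff_divPow σ p j).mul (contDiff_divPow (-σ) q j))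

lemma differentiable_diskPoly (σ : ℂ) (γ : ℝ) (p q : ℕ) (x : ℝ × ℝ) :
    DifferentiableAt ℝ (diskPoly σ γ p q) x :=
  (contDiff_diskPoly σ γ p q).differentiable (by simp) x

lemma wirt_diskPoly {σ : ℂ} (hσ : σ ^ 2 = 1) (γ : ℝ) (p q : ℕ) (x : ℝ × ℝ) :
    wirt σ (diskPoly σ γ p q) x = ∑ j ∈ Finset.range (q + 1),
      dpCoeff γ (p + q) j * (divPow σ p (j + 1) x * divPow (-σ) q j x) := by
  have e : diskPoly σ γ p q = fun x => ∑ j ∈ Finset.range (q + 1),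
      dpCoeff γ (p + q) j * (divPow σ p j x * divPow (-σ) q j x) := by
    ext y; exact diskPoly_eq_sum_range σ γ (by simp) y
  rw [e, wirt_sum]
  · refine Finset.sum_congr rfl fun j _ => ?_
    have h1 := differentiable_divPow σ p j x
    have h2 := differentiable_divPow (-σ) q j x
    rw [wirt_const_mul _ (h1.fun_mul h2), wirt_mul h1 h2, wirt_divPow_self hσ, wirt_divPow_neg hσ]
    simp
  · intro j _
    have h1 := differentiable_divPow σ p j x
    have h2 := differentiable_divPow (-σ) q j x
    exact (h1.fun_mul h2).const_mul _

lemma wirt_diskPoly_zero {σ : ℂ} (hσ : σ ^ 2 = 1) (γ : ℝ) (q : ℕ) (x : ℝ × ℝ) :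
    wirt σ (diskPoly σ γ 0 q) x = 0 := by
  rw [wirt_diskPoly hσ]
  exact Finset.sum_eq_zero fun j _ => by simp [divPow]

lemma wirt_diskPoly_succ {σ : ℂ} (hσ : σ ^ 2 = 1) (γ : ℝ) (p q : ℕ) (x : ℝ × ℝ) :
    wirt σ (diskPoly σ γ (p + 1) q) x = diskPoly σ (γ + 1) p q x := by
  rw [wirt_diskPoly hσ, diskPoly_eq_sum_range σ (γ + 1) (N := q + 1) (by simp)]
  refine Finset.sum_congr rfl fun j _ => ?_
  rw [divPow_succ_succ]
  congr 1
  simp only [dpCoeff]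
  congr 3
  push_cast
  ring

/-- The raising identity `w D Z - (γ + 1) z̄ Z = -(p + γ + 1) (q + 1) Z'` between the disk
polynomials `Z` of parameter `γ + 1` and `Z'` of parameter `γ`. -/
lemma raise_diskPoly {σ : ℂ} (hσ : σ ^ 2 = 1) {γ : ℝ} (hγ : 0 ≤ γ) (p q : ℕ) (x : ℝ × ℝ) :
    bdist x * wirt σ (diskPoly σ (γ + 1) p q) x
        - (γ + 1) * zvar (-σ) x * diskPoly σ (γ + 1) p q x =
      -((p + γ + 1) * (q + 1)) * diskPoly σ γ p (q + 1) x := by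
  rw [bdist_eq_zvar hσ, sub_mul, one_mul]
  -- the part of `w D Z` without the factor `z z̄`, shifted by one index
  have h1 : wirt σ (diskPoly σ (γ + 1) p q) x = ∑ j ∈ Finset.range (q + 2),
      -(j * (p + q + γ + 2 - j)) * dpCoeff (γ + 1) (p + q) j *
        (divPow σ p j x * divPow (-σ) (q + 1) j x) := by
    rw [wirt_diskPoly hσ, Finset.sum_range_succ' _ (q + 1)]
    simp only [Nat.cast_zero, zero_mul, neg_zero, add_zero]
    refine Finset.sum_congr rfl fun j _ => ?_
    rw [divPow_succ_succ]
    by_cases hj : j + 1 ≤ p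
    · have hj' : (j : ℝ) + 1 ≤ p := by exact_mod_cast hj
      have hpos : (p : ℝ) + q + γ + 1 - j ≠ 0 := by
        have : (0 : ℝ) ≤ q := q.cast_nonneg
        intro h; linarith
      have hG : Real.Gamma ((p + q : ℕ) + (γ + 1) + 1 - j) =
          (p + q + γ + 1 - j) * Real.Gamma ((p + q : ℕ) + (γ + 1) + 1 - (j + 1 : ℕ)) := by
        have := Real.Gamma_add_one hpos
        convert this using 2 <;> push_cast <;> ring_nf
      have hf : (j.factorial : ℝ) ≠ 0 := by exact_mod_cast j.factorial_ne_zero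
      have hj1 : (j : ℝ) + 1 ≠ 0 := by positivity
      have hc : dpCoeff (γ + 1) (p + q) j =
          -(((j : ℕ) + 1) * (p + q + γ + 2 - (j + 1))) * dpCoeff (γ + 1) (p + q) (j + 1) := by
        have hr : (-1 : ℝ) ^ j / j.factorial * Real.Gamma ((p + q : ℕ) + (γ + 1) + 1 - j) =
            -((j + 1) * (p + q + γ + 2 - (j + 1))) * ((-1) ^ (j + 1) / (j + 1).factorial *
              Real.Gamma ((p + q : ℕ) + (γ + 1) + 1 - (j + 1 : ℕ))) := by
          rw [hG, Nat.factorial_succ, pow_succ]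
          push_cast
          field_simp
          ring
        simp only [dpCoeff, hr]
        push_cast
        ring
      rw [hc]
      push_cast
      ring
    · simp [divPow_of_lt (not_le.1 hj)]
  have h2 : zvar σ x * zvar (-σ) x * wirt σ (diskPoly σ (γ + 1) p q) x =
      ∑ j ∈ Finset.range (q + 2), (p - j) * (q + 1 - j) * dpCoeff (γ + 1) (p + q) j *
        (divPow σ p j x * divPow (-σ) (q + 1) j x) := by
    rw [wirt_diskPoly hσ, Finset.sum_range_succ _ (q + 1), Finset.mul_sum]
    have : ((q : ℂ) + 1 - ((q + 1 : ℕ) : ℂ)) = 0 := by push_cast; ring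
    rw [this]
    simp only [mul_zero, zero_mul, add_zero]
    refine Finset.sum_congr rfl fun j _ => ?_
    have e1 := zvar_mul_divPow_succ σ p j x
    have e2 := zvar_mul_divPow (-σ) q j x
    linear_combination (dpCoeff (γ + 1) (p + q) j * zvar (-σ) x * divPow (-σ) q j x) * e1 +
      (dpCoeff (γ + 1) (p + q) j * ((p - j) * divPow σ p j x)) * e2
  have h3 : zvar (-σ) x * diskPoly σ (γ + 1) p q x =
      ∑ j ∈ Finset.range (q + 2), (q + 1 - j) * dpCoeff (γ + 1) (p + q) j *
        (divPow σ p j x * divPow (-σ) (q + 1) j x) := by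
    rw [diskPoly_eq_sum_range σ (γ + 1) (N := q + 2) (by simp), Finset.mul_sum]
    refine Finset.sum_congr rfl fun j _ => ?_
    have e2 := zvar_mul_divPow (-σ) q j x
    linear_combination (dpCoeff (γ + 1) (p + q) j * divPow σ p j x) * e2
  rw [h2, mul_assoc _ (zvar (-σ) x), h3, h1,
    diskPoly_eq_sum_range σ γ (N := q + 2) (by simp),
    Finset.mul_sum, Finset.mul_sum, ← Finset.sum_sub_distrib, ← Finset.sum_sub_distrib]
  refine Finset.sum_congr rfl fun j _ => ?_
  have hc : dpCoeff γ (p + (q + 1)) j = dpCoeff (γ + 1) (p + q) j := by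
    simp only [dpCoeff]
    congr 3
    push_cast
    ring
  rw [hc]
  ring

/-- The function `w^α`. -/
noncomputable def wpow (α : ℝ) (x : ℝ × ℝ) : ℂ := ((bdist x ^ α : ℝ) : ℂ)

lemma wirt_wpow_mul_diskPoly {σ : ℂ} (hσ : σ ^ 2 = 1) {γ : ℝ} (hγ : 0 ≤ γ) (p q : ℕ)
    {x : ℝ × ℝ} (hx : x ∈ disk) :
    wirt σ (fun y => wpow (γ + 1) y * diskPoly σ (γ + 1) p q y) x =
      -((p + γ + 1) * (q + 1)) * (wpow γ x * diskPoly σ γ p (q + 1) x) := by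
  have hw : 0 < bdist x := mem_disk_iff.1 hx
  have hG : HasDerivAt (fun t : ℝ => t ^ (γ + 1)) ((γ + 1) * bdist x ^ γ) (bdist x) := by
    simpa using Real.hasDerivAt_rpow_const (p := γ + 1) (Or.inl hw.ne')
  have hd : DifferentiableAt ℝ (wpow (γ + 1)) x := by
    have h1 : DifferentiableAt ℝ bdist x := contDiff_bdist.differentiable (by simp) x
    have h2 := DifferentiableAt.comp x hG.differentiableAt h1
    exact Complex.ofRealCLM.differentiableAt.comp x h2
  have hwp : wpow (γ + 1) x = wpow γ x * bdist x := by
    simp only [wpow]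
    rw [Real.rpow_add_one hw.ne']
    push_cast; ring
  rw [wirt_mul hd (differentiable_diskPoly _ _ _ _ _)]
  have : wirt σ (wpow (γ + 1)) x = -((γ + 1) * wpow γ x) * zvar (-σ) x := by
    unfold wpow
    rw [wirt_comp_bdist hG]
    push_cast; ring
  rw [this, hwp]
  linear_combination wpow γ x * raise_diskPoly hσ hγ p q x

/-! ### Cut-off powers of the weight function -/

/-- Smooth functions on the line that vanish for `t < 1/2` and are a multiple of `t^β` for
`t > 1`. -/
structure IsCutPow (β : ℝ) (G : ℝ → ℝ) : Prop where
  contDiff : ContDiff ℝ ∞ G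
  eq_zero : ∀ t < 1 / 2, G t = 0
  eq_rpow : ∃ c : ℝ, ∀ t > 1, G t = c * t ^ β

lemma IsCutPow.deriv {β : ℝ} {G : ℝ → ℝ} (h : IsCutPow β G) :
    IsCutPow (β - 1) (_root_.deriv G) := by
  refine ⟨((contDiff_infty_iff_deriv).1 h.contDiff).2, fun t ht => ?_, ?_⟩
  · have : G =ᶠ[nhds t] fun _ => 0 := by
      filter_upwards [Iio_mem_nhds ht] with y hy using h.eq_zero y hy
    simp [this.deriv_eq]
  · obtain ⟨c, hc⟩ := h.eq_rpow
    refine ⟨c * β, fun t ht => ?_⟩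
    have : G =ᶠ[nhds t] fun y => c * y ^ β := by
      filter_upwards [Ioi_mem_nhds ht] with y hy using hc y hy
    have h0 : t ≠ 0 := by linarith
    rw [this.deriv_eq, ((Real.hasDerivAt_rpow_const (p := β) (Or.inl h0)).const_mul c).deriv]
    ring

lemma IsCutPow.exists_bound {β : ℝ} {G : ℝ → ℝ} (h : IsCutPow β G) :
    ∃ C, 0 ≤ C ∧ ∀ t > 0, |G t| ≤ C * t ^ β := by
  obtain ⟨c, hc⟩ := h.eq_rpow
  have hcont : ContinuousOn (fun t : ℝ => G t * t ^ (-β)) (Set.Icc (1 / 2) 1) := by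
    apply h.contDiff.continuous.continuousOn.mul
    apply ContinuousOn.rpow_const continuousOn_id
    intro t ht
    left
    have := ht.1
    simp only [id]
    linarith
  obtain ⟨M, hM⟩ := isCompact_Icc.exists_bound_of_continuousOn hcont
  refine ⟨max M |c|, le_max_of_le_right (abs_nonneg c), fun t ht => ?_⟩
  have hpos : 0 < t ^ β := Real.rpow_pos_of_pos ht β
  rcases lt_or_ge t (1 / 2) with h1 | h1
  · rw [h.eq_zero t h1, abs_zero]
    exact mul_nonneg (le_max_of_le_right (abs_nonneg c)) hpos.le
  rcases le_or_gt t 1 with h2 | h2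
  · have := hM t ⟨h1, h2⟩
    rw [Real.norm_eq_abs, abs_mul, Real.rpow_neg ht.le, abs_inv, abs_of_pos hpos,
      ← div_eq_mul_inv, div_le_iff₀ hpos] at this
    exact this.trans (mul_le_mul_of_nonneg_right (le_max_left _ _) hpos.le)
  · rw [hc t h2, abs_mul, abs_of_pos hpos]
    exact mul_le_mul_of_nonneg_right (le_max_right _ _) hpos.le

/-- The power `t^α`, cut off smoothly near `0`. -/
noncomputable def cutPow (α t : ℝ) : ℝ := t ^ α * Real.smoothTransition (2 * t - 1)

lemma cutPow_of_one_lt {α t : ℝ} (ht : 1 < t) : cutPow α t = t ^ α := by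
  rw [cutPow, Real.smoothTransition.one_of_one_le (by linarith), mul_one]

lemma isCutPow_cutPow (α : ℝ) : IsCutPow α (cutPow α) := by
  have hz : ∀ t < 1 / 2, cutPow α t = 0 := fun t ht => by
    rw [cutPow, Real.smoothTransition.zero_of_nonpos (by linarith), mul_zero]
  refine ⟨contDiff_iff_contDiffAt.2 fun t => ?_, hz, 1, fun t ht => ?_⟩
  · rcases lt_or_ge t (1 / 2) with h | h
    · have : cutPow α =ᶠ[nhds t] fun _ => 0 := by
        filter_upwards [Iio_mem_nhds h] with y hy using hz y hy
      exact contDiffAt_const.congr_of_eventuallyEq this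
    · have h0 : t ≠ 0 := by linarith
      unfold cutPow
      refine (Real.contDiffAt_rpow_const_of_ne h0).mul ?_
      exact (Real.smoothTransition.contDiff.comp
        ((contDiff_const.mul contDiff_id).sub contDiff_const)).contDiffAt
  · rw [cutPow_of_one_lt ht, one_mul]

/-- The linear span of the families `ε ↦ ε^β G(w / ε) P`, where `β ≥ α`, `P` is smooth and `G` is a
cut-off power of exponent `β`. By scaling, its members are bounded by a multiple of `w^α` uniformly
in `ε`, and a Wirtinger derivative lowers `α` by one. -/
noncomputable def cutFamilies (α : ℝ) : Submodule ℂ (ℝ → ℝ × ℝ → ℂ) :=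
  Submodule.span ℂ {Φ | ∃ β ≥ α, ∃ G, IsCutPow β G ∧ ∃ P : ℝ × ℝ → ℂ, ContDiff ℝ ∞ P ∧
    Φ = fun ε x => ((ε ^ β * G (bdist x / ε) : ℝ) : ℂ) * P x}

lemma contDiff_of_mem_cutFamilies {α : ℝ} {Φ : ℝ → ℝ × ℝ → ℂ} (h : Φ ∈ cutFamilies α) (ε : ℝ) :
    ContDiff ℝ ∞ (Φ ε) := by
  induction h using Submodule.span_induction with
  | mem Φ h =>
    obtain ⟨β, -, G, hG, P, hP, rfl⟩ := h
    have h1 : ContDiff ℝ ∞ (fun x => ε ^ β * G (bdist x / ε)) :=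
      contDiff_const.mul (hG.contDiff.comp (contDiff_bdist.div_const ε))
    exact (Complex.ofRealCLM.contDiff.comp h1).mul hP
  | zero => exact contDiff_const
  | add Φ Ψ _ _ h1 h2 => exact h1.add h2
  | smul c Φ _ h1 => exact h1.const_smul c

lemma eq_zero_of_mem_cutFamilies {α : ℝ} {Φ : ℝ → ℝ × ℝ → ℂ} (h : Φ ∈ cutFamilies α) {ε : ℝ}
    (hε : 0 < ε) {x : ℝ × ℝ} (hx : bdist x < ε / 2) : Φ ε x = 0 := by
  induction h using Submodule.span_induction with
  | mem Φ h =>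
    obtain ⟨β, -, G, hG, P, hP, rfl⟩ := h
    have : bdist x / ε < 1 / 2 := by rw [div_lt_iff₀ hε]; linarith
    simp [hG.eq_zero _ this]
  | zero => rfl
  | add Φ Ψ _ _ h1 h2 => simp [h1, h2]
  | smul c Φ _ h1 => simp [h1]

lemma disk_subset_closedBall : {x : ℝ × ℝ | 0 ≤ bdist x} ⊆ Metric.closedBall 0 1 := by
  intro x hx
  simp only [Set.mem_ofPred_eq, bdist] at hx
  rw [mem_closedBall_zero_iff, Prod.norm_def, sup_le_iff, Real.norm_eq_abs, Real.norm_eq_abs]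
  exact ⟨abs_le_one_iff_mul_self_le_one.2 (by nlinarith [sq_nonneg x.2]),
    abs_le_one_iff_mul_self_le_one.2 (by nlinarith [sq_nonneg x.1])⟩

lemma exists_bound_on_disk {P : ℝ × ℝ → ℂ} (hP : Continuous P) :
    ∃ M, 0 ≤ M ∧ ∀ x ∈ disk, ‖P x‖ ≤ M := by
  obtain ⟨M, hM⟩ := (isCompact_closedBall (0 : ℝ × ℝ) 1).exists_bound_of_continuousOn
    hP.continuousOn
  exact ⟨max M 0, le_max_right _ _, fun x hx =>
    (hM x (disk_subset_closedBall (mem_disk_iff.1 hx).le)).trans (le_max_left _ _)⟩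

lemma exists_bound_of_mem_cutFamilies {α : ℝ} {Φ : ℝ → ℝ × ℝ → ℂ} (h : Φ ∈ cutFamilies α) :
    ∃ C, ∀ ε > 0, ∀ x ∈ disk, ‖Φ ε x‖ ≤ C * bdist x ^ α := by
  induction h using Submodule.span_induction with
  | mem Φ h =>
    obtain ⟨β, hβ, G, hG, P, hP, rfl⟩ := h
    obtain ⟨C, hC0, hC⟩ := hG.exists_bound
    obtain ⟨M, hM0, hM⟩ := exists_bound_on_disk hP.continuous
    refine ⟨C * M, fun ε hε x hx => ?_⟩
    have hw : 0 < bdist x := mem_disk_iff.1 hx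
    have hεβ : 0 < ε ^ β := Real.rpow_pos_of_pos hε β
    have h1 : |ε ^ β * G (bdist x / ε)| ≤ C * bdist x ^ α := by
      calc |ε ^ β * G (bdist x / ε)| = ε ^ β * |G (bdist x / ε)| := by
            rw [abs_mul, abs_of_pos hεβ]
        _ ≤ ε ^ β * (C * (bdist x / ε) ^ β) := by gcongr; exact hC _ (by positivity)
        _ = C * bdist x ^ β := by rw [Real.div_rpow hw.le hε.le]; field_simp
        _ ≤ C * bdist x ^ α := by
            gcongr ?_ * ?_
            exact Real.rpow_le_rpow_of_exponent_ge hw (bdist_le_one x) hβ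
    calc ‖((ε ^ β * G (bdist x / ε) : ℝ) : ℂ) * P x‖
        = |ε ^ β * G (bdist x / ε)| * ‖P x‖ := by
          rw [norm_mul, Complex.norm_real, Real.norm_eq_abs]
      _ ≤ (C * bdist x ^ α) * M := by gcongr; exact hM x hx
      _ = C * M * bdist x ^ α := by ring
  | zero => exact ⟨0, by simp⟩
  | add Φ Ψ _ _ h1 h2 =>
    obtain ⟨C, hC⟩ := h1
    obtain ⟨K, hK⟩ := h2
    refine ⟨C + K, fun ε hε x hx => (norm_add_le _ _).trans ?_⟩
    rw [add_mul]
    exact add_le_add (hC ε hε x hx) (hK ε hε x hx)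
  | smul c Φ _ h1 =>
    obtain ⟨C, hC⟩ := h1
    refine ⟨‖c‖ * C, fun ε hε x hx => ?_⟩
    change ‖c • Φ ε x‖ ≤ _
    rw [norm_smul, mul_assoc]
    exact mul_le_mul_of_nonneg_left (hC ε hε x hx) (norm_nonneg c)

lemma wirt_mem_cutFamilies {α : ℝ} {Φ : ℝ → ℝ × ℝ → ℂ} (h : Φ ∈ cutFamilies α) (σ : ℂ) :
    (fun ε => wirt σ (Φ ε)) ∈ cutFamilies (α - 1) := by
  induction h using Submodule.span_induction with
  | mem Φ h =>
    obtain ⟨β, hβ, G, hG, P, hP, rfl⟩ := h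
    have hsub : ∀ Ψ ∈ {Φ | ∃ β ≥ α - 1, ∃ G, IsCutPow β G ∧ ∃ P : ℝ × ℝ → ℂ, ContDiff ℝ ∞ P ∧
        Φ = fun ε x => ((ε ^ β * G (bdist x / ε) : ℝ) : ℂ) * P x}, Ψ ∈ cutFamilies (α - 1) :=
      fun Ψ hΨ => Submodule.subset_span hΨ
    have e : (fun ε => wirt σ (fun x => ((ε ^ β * G (bdist x / ε) : ℝ) : ℂ) * P x)) =
        (fun ε x => ((ε ^ (β - 1) * deriv G (bdist x / ε) : ℝ) : ℂ) * (-zvar (-σ) x * P x)) +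
        fun ε x => ((ε ^ β * G (bdist x / ε) : ℝ) : ℂ) * wirt σ P x := by
      ext ε x
      have hG' : HasDerivAt (fun t => ε ^ β * G (t / ε)) (ε ^ (β - 1) * deriv G (bdist x / ε))
          (bdist x) := by
        have h1 : HasDerivAt G (deriv G (bdist x / ε)) (bdist x / ε) :=
          (hG.contDiff.differentiable (by simp) _).hasDerivAt
        have h2 := (h1.comp (bdist x) ((hasDerivAt_id (bdist x)).div_const ε)).const_mul (ε ^ β)
        refine h2.congr_deriv ?_
        rcases eq_or_ne ε 0 with rfl | hε
        · simp [hG.deriv.eq_zero 0 (by norm_num)]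
        · rw [Real.rpow_sub_one hε]
          ring
      have hd1 : DifferentiableAt ℝ (fun y => ((ε ^ β * G (bdist y / ε) : ℝ) : ℂ)) x :=
        Complex.ofRealCLM.differentiableAt.comp x (hG'.differentiableAt.comp x
          (contDiff_bdist.differentiable (by simp) x))
      rw [wirt_mul hd1 (hP.differentiable (by simp) x), wirt_comp_bdist hG']
      simp only [Pi.add_apply]
      ring
    rw [e]
    refine add_mem (hsub _ ⟨β - 1, by linarith, _, hG.deriv, _, ?_, rfl⟩)
      (hsub _ ⟨β, by linarith, G, hG, _, contDiff_wirt σ hP, rfl⟩)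
    exact (contDiff_zvar _).neg.mul hP
  | zero =>
    have : (fun ε => wirt σ ((0 : ℝ → ℝ × ℝ → ℂ) ε)) = 0 := by
      ext ε x; exact wirt_const 0
    rw [this]
    exact zero_mem _
  | add Φ Ψ hΦ hΨ h1 h2 =>
    have : (fun ε => wirt σ ((Φ + Ψ) ε)) = (fun ε => wirt σ (Φ ε)) + fun ε => wirt σ (Ψ ε) := by
      ext ε x
      exact wirt_add ((contDiff_of_mem_cutFamilies hΦ ε).differentiable (by simp) x)
        ((contDiff_of_mem_cutFamilies hΨ ε).differentiable (by simp) x)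
    rw [this]
    exact add_mem h1 h2
  | smul c Φ hΦ h1 =>
    have : (fun ε => wirt σ ((c • Φ) ε)) = c • fun ε => wirt σ (Φ ε) := by
      ext ε x
      exact wirt_const_mul c ((contDiff_of_mem_cutFamilies hΦ ε).differentiable (by simp) x)
    rw [this]
    exact Submodule.smul_mem _ c h1

lemma iterate_wirt_mem_cutFamilies {α : ℝ} {Φ : ℝ → ℝ × ℝ → ℂ} (h : Φ ∈ cutFamilies α) (σ : ℂ)
    (n : ℕ) : (fun ε => (wirt σ)^[n] (Φ ε)) ∈ cutFamilies (α - n) := by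
  induction n generalizing Φ α with
  | zero => simpa using h
  | succ n ih =>
    have := ih (wirt_mem_cutFamilies h σ)
    have e : α - 1 - n = α - (n + 1 : ℕ) := by push_cast; ring
    rwa [e] at this

/-- Complex-valued test functions on the disk. -/
structure IsTest (Φ : ℝ × ℝ → ℂ) : Prop where
  contDiff : ContDiff ℝ ∞ Φ
  hasCompactSupport : HasCompactSupport Φ
  tsupport_subset : tsupport Φ ⊆ disk

lemma isTest_of_mem_cutFamilies {α : ℝ} {Φ : ℝ → ℝ × ℝ → ℂ} (h : Φ ∈ cutFamilies α) {ε : ℝ}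
    (hε : 0 < ε) : IsTest (Φ ε) := by
  have hsub : tsupport (Φ ε) ⊆ {x | ε / 2 ≤ bdist x} := by
    apply closure_minimal
    · intro x hx
      by_contra hlt
      exact hx (eq_zero_of_mem_cutFamilies h hε (not_le.1 hlt))
    · exact isClosed_le continuous_const contDiff_bdist.continuous
  refine ⟨contDiff_of_mem_cutFamilies h ε, ?_, fun x hx => mem_disk_iff.2 ?_⟩
  · refine HasCompactSupport.of_support_subset_isCompact (isCompact_closedBall (0 : ℝ × ℝ) 1) ?_
    intro x hx
    have : ε / 2 ≤ bdist x := hsub (subset_tsupport _ hx)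
    exact disk_subset_closedBall (show 0 ≤ bdist x by linarith)
  · have : ε / 2 ≤ bdist x := hsub hx
    linarith

/-- The family `ε^α χ(w / ε) P` approximating `w^α P`. -/
noncomputable def cutApprox (α : ℝ) (P : ℝ × ℝ → ℂ) (ε : ℝ) (x : ℝ × ℝ) : ℂ :=
  ((ε ^ α * cutPow α (bdist x / ε) : ℝ) : ℂ) * P x

lemma cutApprox_mem {α : ℝ} {P : ℝ × ℝ → ℂ} (hP : ContDiff ℝ ∞ P) :
    cutApprox α P ∈ cutFamilies α :=
  Submodule.subset_span ⟨α, le_rfl, _, isCutPow_cutPow α, P, hP, rfl⟩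

/-- The family agrees with `w^α P` near every point with `w > ε`, so that the derivatives agree
there too. -/
lemma cutApprox_eventuallyEq (α : ℝ) (P : ℝ × ℝ → ℂ) {ε : ℝ} (hε : 0 < ε) {x : ℝ × ℝ}
    (hx : ε < bdist x) : cutApprox α P ε =ᶠ[nhds x] fun y => wpow α y * P y := by
  filter_upwards [(isOpen_lt continuous_const contDiff_bdist.continuous).mem_nhds hx] with y hy
  have hy' : ε < bdist y := hy
  have h1 : 1 < bdist y / ε := by rwa [one_lt_div hε]
  have h2 : ε ^ α * (bdist y / ε) ^ α = bdist y ^ α := by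
    rw [← Real.mul_rpow hε.le (by positivity), mul_div_cancel₀ _ hε.ne']
  simp only [cutApprox, wpow, cutPow_of_one_lt h1, h2]

/-! ### The weighted measure and the pairing identity -/

lemma measurable_weight (γ : ℝ) :
    Measurable (fun p : ℝ × ℝ => ENNReal.ofReal ((1 - (p.1 ^ 2 + p.2 ^ 2)) ^ γ)) := by
  fun_prop

lemma wpow_eq_toReal (γ : ℝ) {x : ℝ × ℝ} (hx : x ∈ disk) :
    wpow γ x = ((ENNReal.ofReal ((1 - (x.1 ^ 2 + x.2 ^ 2)) ^ γ)).toReal : ℂ) := by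
  have : 0 ≤ (1 - (x.1 ^ 2 + x.2 ^ 2)) ^ γ := Real.rpow_nonneg (mem_disk_iff.1 hx).le γ
  rw [ENNReal.toReal_ofReal this]
  rfl

lemma integral_diskMeasure (γ : ℝ) (f : ℝ × ℝ → ℂ) :
    ∫ x, f x ∂(diskMeasure γ) = ∫ x in disk, wpow γ x * f x := by
  rw [diskMeasure, integral_withDensity_eq_integral_toReal_smul (measurable_weight γ)
    (Eventually.of_forall fun x => ENNReal.ofReal_lt_top)]
  refine setIntegral_congr_fun isOpen_disk.measurableSet fun x hx => ?_
  simp only [wpow_eq_toReal γ hx, Complex.real_smul]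

lemma integrable_diskMeasure_iff (γ : ℝ) (f : ℝ × ℝ → ℂ) :
    Integrable f (diskMeasure γ) ↔ IntegrableOn (fun x => wpow γ x * f x) disk := by
  rw [diskMeasure, integrable_withDensity_iff_integrable_smul' (measurable_weight γ)
    (Eventually.of_forall fun x => ENNReal.ofReal_lt_top)]
  refine integrable_congr ?_
  filter_upwards [ae_restrict_mem isOpen_disk.measurableSet] with x hx
  simp only [wpow_eq_toReal γ hx, Complex.real_smul]

lemma ae_diskMeasure_mem (γ : ℝ) : ∀ᵐ x ∂(diskMeasure γ), x ∈ disk :=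
  (withDensity_absolutelyContinuous _ _).ae_le (ae_restrict_mem isOpen_disk.measurableSet)

lemma volume_disk_lt_top : volume disk < ⊤ := by
  have h : disk ⊆ Metric.closedBall (0 : ℝ × ℝ) 1 := fun x hx =>
    disk_subset_closedBall (mem_disk_iff.1 hx).le
  exact (measure_mono h).trans_lt (isCompact_closedBall (0 : ℝ × ℝ) 1).measure_lt_top

lemma isFiniteMeasure_diskMeasure {γ : ℝ} (hγ : 0 ≤ γ) : IsFiniteMeasure (diskMeasure γ) := by
  constructor
  rw [diskMeasure, withDensity_apply _ MeasurableSet.univ, Measure.restrict_univ]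
  calc ∫⁻ p in disk, ENNReal.ofReal ((1 - (p.1 ^ 2 + p.2 ^ 2)) ^ γ)
      ≤ ∫⁻ p in disk, 1 := by
        refine setLIntegral_mono measurable_const fun x hx => ?_
        rw [ENNReal.ofReal_le_one]
        exact Real.rpow_le_one (mem_disk_iff.1 hx).le (bdist_le_one x) hγ
    _ < ⊤ := by simpa using volume_disk_lt_top

lemma integrable_of_continuous {γ : ℝ} (hγ : 0 ≤ γ) {P : ℝ × ℝ → ℂ} (hP : Continuous P) :
    Integrable P (diskMeasure γ) := by
  have := isFiniteMeasure_diskMeasure hγ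
  obtain ⟨M, -, hM⟩ := exists_bound_on_disk hP
  exact Integrable.of_bound hP.aestronglyMeasurable M
    ((ae_diskMeasure_mem γ).mono fun x hx => hM x hx)

lemma aestronglyMeasurable_of_integrable {γ : ℝ} {f : ℝ × ℝ → ℂ}
    (hf : Integrable f (diskMeasure γ)) : AEStronglyMeasurable f (volume.restrict disk) := by
  have h1 := ((integrable_diskMeasure_iff γ f).1 hf).aestronglyMeasurable
  have h2 : Measurable (fun x => (wpow γ x)⁻¹) := by
    unfold wpow bdist; fun_prop
  refine (h2.aestronglyMeasurable.mul h1).congr ?_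
  filter_upwards [ae_restrict_mem isOpen_disk.measurableSet] with x hx
  have : wpow γ x ≠ 0 := by
    unfold wpow
    exact_mod_cast (Real.rpow_pos_of_pos (mem_disk_iff.1 hx) γ).ne'
  simp [this]

/-- Members of a cut-off family of exponent `β` may be tested against integrable functions for the
weight `w^β`, and the pointwise limit as `ε → 0` passes through the integral. -/
lemma tendsto_integral_cutFamilies {β : ℝ} {Ψ : ℝ → ℝ × ℝ → ℂ} (hΨ : Ψ ∈ cutFamilies β)
    {f L : ℝ × ℝ → ℂ} (hf : Integrable f (diskMeasure β))
    (hL : ∀ x ∈ disk, ∀ ε > 0, ε < bdist x → Ψ ε x = L x) :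
    Tendsto (fun n : ℕ => ∫ x in disk, f x * Ψ (1 / ((n : ℝ) + 1)) x) atTop
      (𝓝 (∫ x in disk, f x * L x)) := by
  obtain ⟨C, hC⟩ := exists_bound_of_mem_cutFamilies hΨ
  have hf1 := (integrable_diskMeasure_iff β f).1 hf
  refine tendsto_integral_of_dominated_convergence (fun x => C * ‖wpow β x * f x‖) ?_ ?_ ?_ ?_
  · exact fun n => (aestronglyMeasurable_of_integrable hf).mul
      (contDiff_of_mem_cutFamilies hΨ _).continuous.aestronglyMeasurable
  · exact hf1.norm.const_mul C
  · intro n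
    filter_upwards [ae_restrict_mem isOpen_disk.measurableSet] with x hx
    have h0 : (0 : ℝ) ≤ bdist x ^ β := Real.rpow_nonneg (mem_disk_iff.1 hx).le β
    have h1 := hC (1 / ((n : ℝ) + 1)) (by positivity) x hx
    have h2 : ‖wpow β x‖ = bdist x ^ β := by
      rw [wpow, Complex.norm_real, Real.norm_eq_abs, abs_of_nonneg h0]
    rw [norm_mul, norm_mul, h2]
    calc ‖f x‖ * ‖Ψ (1 / ((n : ℝ) + 1)) x‖ ≤ ‖f x‖ * (C * bdist x ^ β) := by gcongr
      _ = C * (bdist x ^ β * ‖f x‖) := by ring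
  · filter_upwards [ae_restrict_mem isOpen_disk.measurableSet] with x hx
    apply tendsto_const_nhds.congr'
    have := tendsto_one_div_add_atTop_nhds_zero_nat (𝕜 := ℝ)
    filter_upwards [this.eventually (gt_mem_nhds (mem_disk_iff.1 hx))] with n hn
    rw [hL x hx _ (by positivity) hn]

/-- The factor `P(P-1)⋯(P-b+1) · Q(Q-1)⋯(Q-a+1) · (Q+γ+1)⋯(Q+γ+b) · (P+γ+1)⋯(P+γ+a)` by which
`∂_z^a ∂_z̄^b` changes the squared norm of the disk polynomial of bidegree `(Q, P)`. -/
noncomputable def lam (γ : ℝ) (a b P Q : ℕ) : ℝ :=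
  ((P.descFactorial b : ℝ) * ∏ i ∈ Finset.range b, (Q + γ + 1 + i)) *
    ((Q.descFactorial a : ℝ) * ∏ i ∈ Finset.range a, (P + γ + 1 + i))

lemma one_sq' : (1 : ℂ) ^ 2 = 1 := one_pow 2

lemma neg_one_sq' : (-1 : ℂ) ^ 2 = 1 := by norm_num

lemma iterate_wirt_const_mul {σ : ℂ} (c : ℂ) (n : ℕ) {F : ℝ × ℝ → ℂ} {x : ℝ × ℝ}
    (hF : ContDiffAt ℝ ∞ F x) : (wirt σ)^[n] (fun y => c * F y) x = c * (wirt σ)^[n] F x := by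
  induction n generalizing F with
  | zero => rfl
  | succ n ih =>
    have hev : ∀ᶠ y in 𝓝 x, ContDiffAt ℝ 1 F y :=
      (hF.of_le (by simp : (1 : WithTop ℕ∞) ≤ ∞)).eventually (by simp)
    have h3 : wirt σ (fun y => c * F y) =ᶠ[𝓝 x] fun y => c * wirt σ F y := by
      filter_upwards [hev] with y hy
      exact wirt_const_mul c (hy.differentiableAt (by simp))
    have h4 : ContDiffAt ℝ ∞ (wirt σ F) x := by
      have h : ContDiffAt ℝ ∞ (fderiv ℝ F) x := hF.fderiv_right (by simp)
      exact ((h.clm_apply contDiffAt_const).sub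
        (contDiffAt_const.mul (h.clm_apply contDiffAt_const))).div_const 2
    rw [Function.iterate_succ_apply, (iterate_wirt_congr n h3).self_of_nhds, ih h4,
      Function.iterate_succ_apply]

lemma contDiffAt_wpow_mul_diskPoly (σ : ℂ) (α γ : ℝ) (p q : ℕ) {x : ℝ × ℝ} (hx : x ∈ disk) :
    ContDiffAt ℝ ∞ (fun y => wpow α y * diskPoly σ γ p q y) x := by
  refine ContDiffAt.mul ?_ (contDiff_diskPoly _ _ _ _).contDiffAt
  have h6 : ContDiffAt ℝ ∞ (fun y => bdist y ^ α) x :=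
    (Real.contDiffAt_rpow_const_of_ne (mem_disk_iff.1 hx).ne').comp x contDiff_bdist.contDiffAt
  exact Complex.ofRealCLM.contDiff.contDiffAt.comp x h6

/-- Repeated differentiation of `w^{γ+a} Z` lowers the exponent of `w` by one in each step and yields
a disk polynomial of higher degree. -/
lemma iterate_wirt_wpow_mul_diskPoly {σ : ℂ} (hσ : σ ^ 2 = 1) {γ : ℝ} (hγ : 0 ≤ γ) (a p q : ℕ)
    {x : ℝ × ℝ} (hx : x ∈ disk) :
    (wirt σ)^[a] (fun y => wpow (γ + a) y * diskPoly σ (γ + a) p q y) x =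
      (-1) ^ a * (((q + a).descFactorial a : ℝ) * ∏ i ∈ Finset.range a, (p + γ + 1 + i) : ℝ) *
        (wpow γ x * diskPoly σ γ p (q + a) x) := by
  induction a generalizing q with
  | zero => simp
  | succ a ih =>
    have e : γ + (a + 1 : ℕ) = γ + a + 1 := by push_cast; ring
    have hga : 0 ≤ γ + a := by positivity
    have h1 : wirt σ (fun y => wpow (γ + a + 1) y * diskPoly σ (γ + a + 1) p q y) =ᶠ[𝓝 x]
        fun y => (-((p + γ + a + 1) * (q + 1)) : ℂ) *
          (wpow (γ + a) y * diskPoly σ (γ + a) p (q + 1) y) := by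
      filter_upwards [isOpen_disk.mem_nhds hx] with y hy
      rw [wirt_wpow_mul_diskPoly hσ hga p q hy]
      push_cast
      ring
    rw [Function.iterate_succ_apply, e, (iterate_wirt_congr a h1).self_of_nhds]
    rw [iterate_wirt_const_mul _ a (contDiffAt_wpow_mul_diskPoly _ _ _ _ _ hx), ih,
      Finset.prod_range_succ,
      show q + 1 + a = (q + a) + 1 by ring, show q + (a + 1) = (q + a) + 1 by ring,
      Nat.descFactorial_succ (q + a + 1) a, show q + a + 1 - a = q + 1 by omega]
    push_cast
    ring

/-- If `g` is the derivative `∂_z^a ∂_z̄^b f` of `f` in the weak sense, then testing it against a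
weighted disk polynomial gives a multiple of the corresponding coefficient of `f`. No boundary
terms arise because the weight has the additional factor `w^{a+b}`. -/
lemma pairing {γ : ℝ} (hγ : 0 ≤ γ) {f g : ℝ × ℝ → ℂ} (a b p q : ℕ)
    (hf : Integrable f (diskMeasure γ)) (hg : Integrable g (diskMeasure (γ + (a + b : ℕ))))
    (h : ∀ Φ, IsTest Φ → ∫ x in disk, f x * ((wirt 1)^[a] ((wirt (-1))^[b] Φ)) x =
      (-1) ^ (a + b) * ∫ x in disk, g x * Φ x) :
    ∫ x, g x * diskPoly 1 (γ + (a + b : ℕ)) p q x ∂(diskMeasure (γ + (a + b : ℕ))) =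
      lam γ a b (p + b) (q + a) * ∫ x, f x * diskPoly 1 γ (p + b) (q + a) x ∂(diskMeasure γ) := by
  set α := γ + (a + b : ℕ) with hα
  set Z := diskPoly 1 α p q with hZ
  have hmem : cutApprox α Z ∈ cutFamilies α := cutApprox_mem (contDiff_diskPoly _ _ _ _)
  have hmem2 := iterate_wirt_mem_cutFamilies (iterate_wirt_mem_cutFamilies hmem (-1) b) 1 a
  have e : α - b - a = γ := by rw [hα]; push_cast; ring
  rw [e] at hmem2
  have hR := tendsto_integral_cutFamilies hmem hg (L := fun x => wpow α x * Z x)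
    (fun x _ ε hε hlt => (cutApprox_eventuallyEq α Z hε hlt).self_of_nhds)
  have hL := tendsto_integral_cutFamilies hmem2 hf
    (L := (wirt 1)^[a] ((wirt (-1))^[b] fun x => wpow α x * Z x))
    (fun x _ ε hε hlt => (iterate_wirt_congr a (iterate_wirt_congr b
      (cutApprox_eventuallyEq α Z hε hlt))).self_of_nhds)
  have heq : ∀ n : ℕ, ∫ x in disk, f x *
      (wirt 1)^[a] ((wirt (-1))^[b] (cutApprox α Z (1 / ((n : ℝ) + 1)))) x =
      (-1) ^ (a + b) * ∫ x in disk, g x * cutApprox α Z (1 / ((n : ℝ) + 1)) x :=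
    fun n => h _ (isTest_of_mem_cutFamilies hmem (by positivity))
  simp only [heq] at hL
  have hlim := tendsto_nhds_unique hL (hR.const_mul ((-1) ^ (a + b)))
  have hD : ∀ x ∈ disk, (wirt 1)^[a] ((wirt (-1))^[b] fun x => wpow α x * Z x) x =
      (-1) ^ (a + b) * lam γ a b (p + b) (q + a) *
        (wpow γ x * diskPoly 1 γ (p + b) (q + a) x) := by
    intro x hx
    have hb : (wirt (-1))^[b] (fun x => wpow α x * Z x) =ᶠ[𝓝 x] fun y =>
        (-1) ^ b * (((p + b).descFactorial b : ℝ) *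
          ∏ i ∈ Finset.range b, (q + (γ + a) + 1 + i) : ℝ) *
        (wpow (γ + a) y * diskPoly 1 (γ + a) (p + b) q y) := by
      filter_upwards [isOpen_disk.mem_nhds hx] with y hy
      have := iterate_wirt_wpow_mul_diskPoly neg_one_sq' (γ := γ + a) (by positivity) b q p hy
      simp only [diskPoly_neg 1] at this
      rw [← this, hZ, show α = γ + a + b by rw [hα]; push_cast; ring]
    rw [(iterate_wirt_congr a hb).self_of_nhds,
      iterate_wirt_const_mul _ a (contDiffAt_wpow_mul_diskPoly _ _ _ _ _ hx),
      iterate_wirt_wpow_mul_diskPoly one_sq' hγ a _ _ hx, lam]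
    have hprod : ∏ i ∈ Finset.range b, ((q : ℝ) + (γ + a) + 1 + i) =
        ∏ i ∈ Finset.range b, (((q + a : ℕ) : ℝ) + γ + 1 + i) :=
      Finset.prod_congr rfl fun i _ => by push_cast; ring
    rw [hprod]
    push_cast
    ring
  rw [integral_diskMeasure, integral_diskMeasure]
  have e1 : ∫ x in disk, g x * (wpow α x * Z x) = ∫ x in disk, wpow α x * (g x * Z x) := by
    congr 1; ext x; ring
  have e2 : ∫ x in disk, f x * (wirt 1)^[a] ((wirt (-1))^[b] fun x => wpow α x * Z x) x =
      (-1) ^ (a + b) * lam γ a b (p + b) (q + a) *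
        ∫ x in disk, wpow γ x * (f x * diskPoly 1 γ (p + b) (q + a) x) := by
    rw [← integral_const_mul]
    refine setIntegral_congr_fun isOpen_disk.measurableSet fun x hx => ?_
    simp only [hD x hx]
    ring
  rw [e1, e2, mul_assoc] at hlim
  exact (mul_left_cancel₀ (pow_ne_zero _ (by norm_num)) hlim).symm

/-! ### Orthogonality of the disk polynomials -/

lemma conj_diskPoly (γ : ℝ) (p q : ℕ) (x : ℝ × ℝ) :
    (starRingEnd ℂ) (diskPoly 1 γ p q x) = diskPoly 1 γ q p x := by
  have hz : ∀ τ : ℝ, (starRingEnd ℂ) (zvar τ x) = zvar (-τ) x := by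
    intro τ; simp [zvar]
  have hd : ∀ (τ : ℝ) (n j : ℕ), (starRingEnd ℂ) (divPow τ n j x) = divPow (-τ) n j x := by
    intro τ n j
    unfold divPow
    split_ifs <;> simp [hz]
  have h1 := hd 1
  have h2 := hd (-1)
  simp only [Complex.ofReal_one, Complex.ofReal_neg, neg_neg] at h1 h2
  rw [← diskPoly_neg]
  unfold diskPoly
  simp only [map_sum, map_mul, h1, h2, dpCoeff, Complex.conj_ofReal, neg_neg]

lemma IsTest.wirt {Φ : ℝ × ℝ → ℂ} (h : IsTest Φ) (σ : ℂ) : IsTest (wirt σ Φ) := by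
  have hsub : tsupport (WeightedDisk.wirt σ Φ) ⊆ tsupport Φ := by
    refine closure_minimal (fun x hx => ?_) (isClosed_tsupport _)
    by_contra hx'
    have := wirt_congr (σ := σ) (notMem_tsupport_iff_eventuallyEq.1 hx')
    exact hx (this.self_of_nhds.trans (wirt_const 0))
  exact ⟨contDiff_wirt σ h.contDiff, h.hasCompactSupport.mono' ((subset_tsupport _).trans hsub),
    hsub.trans h.tsupport_subset⟩

lemma IsTest.iterate_wirt {Φ : ℝ × ℝ → ℂ} (h : IsTest Φ) (σ : ℂ) (n : ℕ) :
    IsTest ((WeightedDisk.wirt σ)^[n] Φ) := by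
  induction n generalizing Φ with
  | zero => exact h
  | succ n ih => exact ih (h.wirt σ)

lemma IsTest.eq_zero {Φ : ℝ × ℝ → ℂ} (h : IsTest Φ) {x : ℝ × ℝ} (hx : x ∉ disk) : Φ x = 0 :=
  image_eq_zero_of_notMem_tsupport fun h' => hx (h.tsupport_subset h')

lemma IsTest.setIntegral_mul {Φ : ℝ × ℝ → ℂ} (h : IsTest Φ) (f : ℝ × ℝ → ℂ) :
    ∫ x in disk, f x * Φ x = ∫ x, f x * Φ x :=
  setIntegral_eq_integral_of_forall_compl_eq_zero fun x hx => by simp [h.eq_zero hx]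

lemma integral_mul_wirt {f Φ : ℝ × ℝ → ℂ} (hf : ContDiff ℝ ∞ f) (hΦ : IsTest Φ) (σ : ℂ) :
    ∫ x in disk, f x * wirt σ Φ x = -∫ x in disk, wirt σ f x * Φ x := by
  rw [(hΦ.wirt σ).setIntegral_mul, hΦ.setIntegral_mul]
  have hcs := hΦ.hasCompactSupport
  have hf' : ∀ v, Continuous fun x => fderiv ℝ f x v := fun v =>
    (hf.continuous_fderiv (by simp)).clm_apply continuous_const
  have hΦ' : ∀ v, Continuous fun x => fderiv ℝ Φ x v := fun v =>
    (hΦ.contDiff.continuous_fderiv (by simp)).clm_apply continuous_const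
  have hi1 : ∀ v, Integrable fun x => fderiv ℝ f x v * Φ x := fun v =>
    ((hf' v).mul hΦ.contDiff.continuous).integrable_of_hasCompactSupport hcs.mul_left
  have hi2 : ∀ v, Integrable fun x => f x * fderiv ℝ Φ x v := fun v =>
    (hf.continuous.mul (hΦ' v)).integrable_of_hasCompactSupport
      (hcs.fderiv_apply (𝕜 := ℝ) v).mul_left
  have hi3 : Integrable fun x => f x * Φ x :=
    (hf.continuous.mul hΦ.contDiff.continuous).integrable_of_hasCompactSupport hcs.mul_left
  have key : ∀ v, ∫ x, f x * fderiv ℝ Φ x v = -∫ x, fderiv ℝ f x v * Φ x := fun v =>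
    integral_mul_fderiv_eq_neg_fderiv_mul_of_integrable (hi1 v) (hi2 v) hi3
      (fun x _ => hf.differentiable (by simp) x)
      (fun x _ => hΦ.contDiff.differentiable (by simp) x)
  have e1 : ∫ x, f x * wirt σ Φ x = ((∫ x, f x * fderiv ℝ Φ x (1, 0)) -
      σ * Complex.I * ∫ x, f x * fderiv ℝ Φ x (0, 1)) / 2 := by
    rw [← integral_const_mul, ← integral_sub (hi2 _) ((hi2 _).const_mul _), ← integral_div]
    congr 1; ext x; simp only [wirt]; ring
  have e2 : ∫ x, wirt σ f x * Φ x = ((∫ x, fderiv ℝ f x (1, 0) * Φ x) -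
      σ * Complex.I * ∫ x, fderiv ℝ f x (0, 1) * Φ x) / 2 := by
    rw [← integral_const_mul, ← integral_sub (hi1 _) ((hi1 _).const_mul _), ← integral_div]
    congr 1; ext x; simp only [wirt]; ring
  rw [e1, e2, key, key]
  ring

lemma integral_mul_iterate_wirt {f Φ : ℝ × ℝ → ℂ} (hf : ContDiff ℝ ∞ f) (hΦ : IsTest Φ) (σ : ℂ)
    (n : ℕ) : ∫ x in disk, f x * (wirt σ)^[n] Φ x =
      (-1) ^ n * ∫ x in disk, (wirt σ)^[n] f x * Φ x := by
  induction n generalizing f with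
  | zero => simp
  | succ n ih =>
    rw [Function.iterate_succ_apply', integral_mul_wirt hf (hΦ.iterate_wirt σ n),
      ih (contDiff_wirt σ hf), Function.iterate_succ_apply]
    ring

/-- The pairing identity for smooth functions. -/
lemma pairing_of_contDiff {γ : ℝ} (hγ : 0 ≤ γ) {f : ℝ × ℝ → ℂ} (hf : ContDiff ℝ ∞ f)
    (a b p q : ℕ) :
    ∫ x, (wirt (-1))^[b] ((wirt 1)^[a] f) x * diskPoly 1 (γ + (a + b : ℕ)) p q x
        ∂(diskMeasure (γ + (a + b : ℕ))) =
      lam γ a b (p + b) (q + a) * ∫ x, f x * diskPoly 1 γ (p + b) (q + a) x ∂(diskMeasure γ) := by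
  have hfa := contDiff_iterate_wirt 1 a hf
  have hg := contDiff_iterate_wirt (-1) b hfa
  refine pairing hγ a b p q (integrable_of_continuous hγ hf.continuous)
    (integrable_of_continuous (by positivity) hg.continuous) fun Φ hΦ => ?_
  rw [integral_mul_iterate_wirt hf (hΦ.iterate_wirt (-1) b), integral_mul_iterate_wirt hfa hΦ,
    pow_add, mul_assoc]

lemma lam_pos {γ : ℝ} (hγ : 0 ≤ γ) {a b P Q : ℕ} (hb : b ≤ P) (ha : a ≤ Q) :
    0 < lam γ a b P Q := by
  have h1 : 0 < P.descFactorial b := Nat.descFactorial_pos.2 hb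
  have h2 : 0 < Q.descFactorial a := Nat.descFactorial_pos.2 ha
  unfold lam
  have h3 : 0 < ∏ i ∈ Finset.range b, ((Q : ℝ) + γ + 1 + i) :=
    Finset.prod_pos fun i _ => by positivity
  have h4 : 0 < ∏ i ∈ Finset.range a, ((P : ℝ) + γ + 1 + i) :=
    Finset.prod_pos fun i _ => by positivity
  positivity

lemma integral_diskPoly_succ_right {γ : ℝ} (hγ : 0 ≤ γ) {f : ℝ × ℝ → ℂ} (hf : ContDiff ℝ ∞ f)
    (p q : ℕ)
    (h : ∫ x, wirt 1 f x * diskPoly 1 (γ + 1) p q x ∂(diskMeasure (γ + 1)) = 0) :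
    ∫ x, f x * diskPoly 1 γ p (q + 1) x ∂(diskMeasure γ) = 0 := by
  have := pairing_of_contDiff hγ hf 1 0 p q
  simp only [Function.iterate_one, Function.iterate_zero, id, add_zero, Nat.cast_one, h] at this
  have h0 : (lam γ 1 0 p (q + 1) : ℂ) ≠ 0 := by
    exact_mod_cast (lam_pos hγ (by omega) (by omega)).ne'
  exact (mul_eq_zero.1 this.symm).resolve_left h0

lemma integral_diskPoly_succ_left {γ : ℝ} (hγ : 0 ≤ γ) {f : ℝ × ℝ → ℂ} (hf : ContDiff ℝ ∞ f)
    (p q : ℕ)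
    (h : ∫ x, wirt (-1) f x * diskPoly 1 (γ + 1) p q x ∂(diskMeasure (γ + 1)) = 0) :
    ∫ x, f x * diskPoly 1 γ (p + 1) q x ∂(diskMeasure γ) = 0 := by
  have := pairing_of_contDiff hγ hf 0 1 p q
  simp only [Function.iterate_one, Function.iterate_zero, id, add_zero, zero_add, Nat.cast_one,
    h] at this
  have h0 : (lam γ 0 1 (p + 1) q : ℂ) ≠ 0 := by
    exact_mod_cast (lam_pos hγ (by omega) (by omega)).ne'
  exact (mul_eq_zero.1 this.symm).resolve_left h0

lemma wirt_neg_diskPoly_succ (γ : ℝ) (p q : ℕ) :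
    wirt (-1) (diskPoly 1 γ p (q + 1)) = diskPoly 1 (γ + 1) p q := by
  ext x
  have e : diskPoly 1 γ p (q + 1) = diskPoly (-1) γ (q + 1) p := by
    ext y; rw [diskPoly_neg]
  rw [e, wirt_diskPoly_succ neg_one_sq', diskPoly_neg]

lemma wirt_neg_diskPoly_zero (γ : ℝ) (p : ℕ) (x : ℝ × ℝ) :
    wirt (-1) (diskPoly 1 γ p 0) x = 0 := by
  have e : diskPoly 1 γ p 0 = diskPoly (-1) γ 0 p := by
    ext y; rw [diskPoly_neg]
  rw [e, wirt_diskPoly_zero neg_one_sq']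

lemma wirt_one_diskPoly_succ (γ : ℝ) (p q : ℕ) :
    wirt 1 (diskPoly 1 γ (p + 1) q) = diskPoly 1 (γ + 1) p q := by
  ext x; exact wirt_diskPoly_succ one_sq' γ p q x

/-- Orthogonality, in bilinear form: since `Z_{q,p}` is the conjugate of `Z_{p,q}`, the exceptional pair
is `(p', q') = (q, p)`. The pairing identity lowers the degree until a derivative vanishes. -/
lemma integral_diskPoly_mul_eq_zero {γ : ℝ} (hγ : 0 ≤ γ) (p q p' q' : ℕ)
    (h : (p', q') ≠ (q, p)) :
    ∫ x, diskPoly 1 γ p' q' x * diskPoly 1 γ p q x ∂(diskMeasure γ) = 0 := by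
  have hs := fun (γ : ℝ) (p q : ℕ) => contDiff_diskPoly 1 γ p q
  obtain ⟨N, hN⟩ : ∃ N, p + q = N := ⟨_, rfl⟩
  induction N generalizing γ p q p' q' with
  | zero =>
    obtain rfl : p = 0 := by omega
    obtain rfl : q = 0 := by omega
    simp only [mul_comm (diskPoly 1 γ p' q' _)]
    rcases q' with _ | q'
    · rcases p' with _ | p'
      · exact absurd rfl h
      · exact integral_diskPoly_succ_left hγ (hs _ _ _) p' 0 (by simp [wirt_neg_diskPoly_zero])
    · exact integral_diskPoly_succ_right hγ (hs _ _ _) p' q'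
        (by simp [wirt_diskPoly_zero one_sq'])
  | succ N ih =>
    rcases q with _ | q
    · rcases p with _ | p
      · omega
      · refine integral_diskPoly_succ_left hγ (hs _ _ _) p 0 ?_
        rcases q' with _ | q'
        · simp [wirt_neg_diskPoly_zero]
        · rw [wirt_neg_diskPoly_succ]
          exact ih (by positivity) _ _ _ _ (by simp at h ⊢; omega) (by omega)
    · refine integral_diskPoly_succ_right hγ (hs _ _ _) p q ?_
      rcases p' with _ | p'
      · simp [wirt_diskPoly_zero one_sq']
      · rw [wirt_one_diskPoly_succ]
        exact ih (by positivity) _ _ _ _ (by simp at h ⊢; omega) (by omega)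

/-- The squared norm of a disk polynomial in the weighted space. -/
noncomputable def dpNormSq (γ : ℝ) (p q : ℕ) : ℝ :=
  ∫ x, ‖diskPoly 1 γ p q x‖ ^ 2 ∂(diskMeasure γ)

lemma dpNormSq_comm (γ : ℝ) (p q : ℕ) : dpNormSq γ p q = dpNormSq γ q p := by
  unfold dpNormSq
  simp only [← conj_diskPoly γ q p, RCLike.norm_conj]

lemma integral_diskPoly_mul_self (γ : ℝ) (p q : ℕ) :
    ∫ x, diskPoly 1 γ q p x * diskPoly 1 γ p q x ∂(diskMeasure γ) = dpNormSq γ p q := by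
  simp only [dpNormSq, ← conj_diskPoly γ p q, Complex.conj_mul']
  rw [← integral_complex_ofReal]
  push_cast
  rfl

lemma iterate_wirt_diskPoly (γ : ℝ) (a b p q : ℕ) :
    (wirt (-1))^[b] ((wirt 1)^[a] (diskPoly 1 γ (q + a) (p + b))) =
      diskPoly 1 (γ + (a + b : ℕ)) q p := by
  have h1 : ∀ (γ : ℝ) (m : ℕ), (wirt 1)^[a] (diskPoly 1 γ (q + a) m) = diskPoly 1 (γ + a) q m := by
    intro γ m
    induction a generalizing γ with
    | zero => simp
    | succ a ih =>
      rw [Function.iterate_succ_apply, ← add_assoc, wirt_one_diskPoly_succ, ih]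
      push_cast; ring_nf
  have h2 : ∀ (γ : ℝ), (wirt (-1))^[b] (diskPoly 1 γ q (p + b)) = diskPoly 1 (γ + b) q p := by
    intro γ
    clear h1
    induction b generalizing γ with
    | zero => simp
    | succ b ih =>
      rw [Function.iterate_succ_apply, ← add_assoc, wirt_neg_diskPoly_succ, ih]
      push_cast; ring_nf
  rw [h1, h2]
  push_cast; ring_nf

/-- The pairing identity applied to a disk polynomial and its conjugate. -/
lemma dpNormSq_eq_lam_mul {γ : ℝ} (hγ : 0 ≤ γ) (a b p q : ℕ) :
    dpNormSq (γ + (a + b : ℕ)) p q = lam γ a b (p + b) (q + a) * dpNormSq γ (p + b) (q + a) := by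
  have h := pairing_of_contDiff hγ (contDiff_diskPoly 1 γ (q + a) (p + b)) a b p q
  rw [iterate_wirt_diskPoly, integral_diskPoly_mul_self, integral_diskPoly_mul_self] at h
  exact_mod_cast h

/-- Differentiating `p + q` times reduces the positivity to that of the total mass of the measure. -/
lemma dpNormSq_pos {γ : ℝ} (hγ : 0 ≤ γ) (p q : ℕ) : 0 < dpNormSq γ p q := by
  have h0 : 0 ≤ dpNormSq γ p q := integral_nonneg fun x => by positivity
  refine h0.lt_of_ne fun h => ?_
  have h1 := dpNormSq_eq_lam_mul hγ q p 0 0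
  simp only [zero_add, ← h, mul_zero] at h1
  set δ := γ + (q + p : ℕ)
  have hδ : 0 ≤ δ := by positivity
  have hZ : ∀ x, diskPoly 1 δ 0 0 x = Real.Gamma (δ + 1) := by
    intro x; simp [diskPoly, dpCoeff, divPow]
  have := isFiniteMeasure_diskMeasure hδ
  simp only [dpNormSq, hZ] at h1
  rw [integral_const, smul_eq_mul] at h1
  have hG : Real.Gamma (δ + 1) ≠ 0 := (Real.Gamma_pos_of_pos (by positivity)).ne'
  have h2 : diskMeasure δ Set.univ = 0 := by
    have := (mul_eq_zero.1 h1).resolve_right (by simpa using hG)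
    exact (measureReal_eq_zero_iff).1 this
  rw [diskMeasure, withDensity_apply _ MeasurableSet.univ, Measure.restrict_univ,
    lintegral_eq_zero_iff (measurable_weight δ)] at h2
  have h3 : ∀ᵐ x ∂(volume.restrict disk), False := by
    filter_upwards [h2, ae_restrict_mem isOpen_disk.measurableSet] with x hx hxd
    simp only [Pi.zero_apply, ENNReal.ofReal_eq_zero] at hx
    exact absurd (Real.rpow_pos_of_pos (mem_disk_iff.1 hxd) δ) (not_lt.2 hx)
  rw [Filter.eventually_false_iff_eq_bot, ae_eq_bot, Measure.restrict_eq_zero] at h3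
  exact (isOpen_disk.measure_pos volume ⟨0, by simp [disk]⟩).ne' h3

/-! ### Completeness of the disk polynomials -/

/-- The retraction `z / max(1, |z|)` of the plane onto the closed unit disk of `ℂ`. -/
noncomputable def diskRetract (x : ℝ × ℝ) : Metric.closedBall (0 : ℂ) 1 :=
  ⟨zvar 1 x / (max 1 ‖zvar 1 x‖ : ℝ), by
    rw [mem_closedBall_zero_iff, norm_div, Complex.norm_real, Real.norm_eq_abs,
      abs_of_pos (by positivity)]
    exact div_le_one_of_le₀ (le_max_right _ _) (by positivity)⟩

lemma continuous_diskRetract : Continuous diskRetract := by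
  refine Continuous.subtype_mk ?_ _
  have h := (contDiff_zvar 1).continuous
  refine h.div ?_ ?_
  · exact Complex.continuous_ofReal.comp (continuous_const.max h.norm)
  · intro x
    have : 0 < max 1 ‖zvar 1 x‖ := by positivity
    exact_mod_cast this.ne'

lemma coe_diskRetract {x : ℝ × ℝ} (hx : x ∈ disk) : (diskRetract x : ℂ) = zvar 1 x := by
  have h1 : ‖zvar 1 x‖ ≤ 1 := by
    have h := bdist_eq_zvar one_sq' x
    have h2 : (starRingEnd ℂ) (zvar 1 x) = zvar (-1) x := by simp [zvar]
    rw [← h2, Complex.mul_conj'] at h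
    have h3 : bdist x = 1 - ‖zvar 1 x‖ ^ 2 := by exact_mod_cast h
    have h4 := mem_disk_iff.1 hx
    exact (abs_le_one_iff_mul_self_le_one.2 (by nlinarith) |> (le_abs_self _).trans)
  simp [diskRetract, max_eq_left h1]

/-- The disk polynomials of bidegree `(m - j, k - j)` determine the moments `∫ f z^m z̄^k`. -/
lemma integral_mul_zvar_pow_eq_zero {γ : ℝ} (hγ : 0 ≤ γ) {f : ℝ × ℝ → ℂ}
    (hf : Integrable f (diskMeasure γ))
    (h : ∀ p q, ∫ x, f x * diskPoly 1 γ p q x ∂(diskMeasure γ) = 0) (m k : ℕ) :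
    ∫ x, f x * (zvar 1 x ^ m * zvar (-1) x ^ k) ∂(diskMeasure γ) = 0 := by
  have hint : ∀ P : ℝ × ℝ → ℂ, Continuous P → Integrable (fun x => f x * P x) (diskMeasure γ) := by
    intro P hP
    obtain ⟨M, -, hM⟩ := exists_bound_on_disk hP
    exact hf.mul_bdd (c := M) hP.aestronglyMeasurable
      ((ae_diskMeasure_mem γ).mono fun x hx => hM x hx)
  induction m using Nat.strong_induction_on generalizing k with
  | _ m ih =>
    have h1 := h m k
    have hcont : ∀ j, Continuous fun x => divPow 1 m j x * divPow (-1) k j x := fun j =>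
      (contDiff_divPow 1 m j).continuous.mul (contDiff_divPow (-1) k j).continuous
    have e : ∀ x, f x * diskPoly 1 γ m k x = ∑ j ∈ Finset.range (m + 1),
        dpCoeff γ (m + k) j * (f x * (divPow 1 m j x * divPow (-1) k j x)) := by
      intro x
      rw [diskPoly, Finset.mul_sum]
      exact Finset.sum_congr rfl fun j _ => by ring
    simp only [e] at h1
    rw [integral_finsetSum _ fun j _ => (hint _ (hcont j)).const_mul _,
      Finset.sum_range_succ', Finset.sum_eq_zero, zero_add, integral_const_mul] at h1
    · have hc : dpCoeff γ (m + k) 0 ≠ 0 := by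
        have : 0 < Real.Gamma ((m + k : ℕ) + γ + 1) := Real.Gamma_pos_of_pos (by positivity)
        simp only [dpCoeff, pow_zero, Nat.factorial_zero, Nat.cast_one, div_one, one_mul,
          Nat.cast_zero, sub_zero]
        exact_mod_cast this.ne'
      have h2 := (mul_eq_zero.1 h1).resolve_left hc
      have e2 : ∀ x, f x * (zvar 1 x ^ m * zvar (-1) x ^ k) = ((m.factorial : ℂ) * k.factorial) *
          (f x * (divPow 1 m 0 x * divPow (-1) k 0 x)) := by
        intro x
        have hm : (m.factorial : ℂ) ≠ 0 := by exact_mod_cast m.factorial_ne_zero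
        have hk : (k.factorial : ℂ) ≠ 0 := by exact_mod_cast k.factorial_ne_zero
        simp only [divPow, Nat.zero_le, if_true, Nat.sub_zero]
        field_simp
      simp only [e2]
      rw [integral_const_mul, h2, mul_zero]
    · intro j hj
      have hj' : j + 1 ≤ m := by simpa using hj
      rw [integral_const_mul]
      by_cases hjk : j + 1 ≤ k
      · have e3 : ∀ x, f x * (divPow 1 m (j + 1) x * divPow (-1) k (j + 1) x) =
            (1 / ((m - (j + 1)).factorial * (k - (j + 1)).factorial) : ℂ) *
            (f x * (zvar 1 x ^ (m - (j + 1)) * zvar (-1) x ^ (k - (j + 1)))) := by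
          intro x
          simp only [divPow, hj', hjk, if_true]
          ring
        simp only [e3]
        rw [integral_const_mul, ih _ (by omega), mul_zero, mul_zero]
      · simp [divPow_of_lt (not_le.1 hjk)]

/-- An integrable function orthogonal to all disk polynomials vanishes: by the Stone-Weierstrass
theorem it is orthogonal to all continuous functions. -/
lemma ae_eq_zero_of_integral_diskPoly {γ : ℝ} (hγ : 0 ≤ γ) {f : ℝ × ℝ → ℂ}
    (hf : Integrable f (diskMeasure γ))
    (h : ∀ p q, ∫ x, f x * diskPoly 1 γ p q x ∂(diskMeasure γ) = 0) :
    ∀ᵐ x ∂(diskMeasure γ), f x = 0 := by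
  have := isFiniteMeasure_diskMeasure hγ
  let K := Metric.closedBall (0 : ℂ) 1
  have hKc : CompactSpace K := isCompact_iff_compactSpace.1 (isCompact_closedBall _ _)
  have hint : ∀ φ : C(K, ℂ), Integrable (fun x => f x * φ (diskRetract x)) (diskMeasure γ) := by
    intro φ
    exact hf.mul_bdd (c := ‖φ‖)
      (φ.continuous.comp continuous_diskRetract).aestronglyMeasurable
      (Eventually.of_forall fun x => φ.norm_coe_le_norm _)
  let Lin : C(K, ℂ) →ₗ[ℂ] ℂ :=
    { toFun := fun φ => ∫ x, f x * φ (diskRetract x) ∂(diskMeasure γ)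
      map_add' := fun φ ψ => by
        rw [← integral_add (hint φ) (hint ψ)]
        congr 1; ext x; simp [mul_add]
      map_smul' := fun c φ => by
        rw [RingHom.id_apply, smul_eq_mul, ← integral_const_mul]
        congr 1; ext x; simp; ring }
  let Λ : C(K, ℂ) →L[ℂ] ℂ := Lin.mkContinuous (∫ x, ‖f x‖ ∂(diskMeasure γ)) fun φ => by
    refine (norm_integral_le_integral_norm _).trans ?_
    rw [← integral_mul_const]
    refine integral_mono (hint φ).norm (hf.norm.mul_const _) fun x => ?_
    simp only [norm_mul]
    exact mul_le_mul_of_nonneg_left (φ.norm_coe_le_norm _) (norm_nonneg _)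
  have hΛ : ∀ φ, Λ φ = ∫ x, f x * φ (diskRetract x) ∂(diskMeasure γ) := fun φ => rfl
  have hpoly : ∀ φ ∈ (polynomialFunctions K).starClosure, Λ φ = 0 := by
    intro φ hφ
    rw [polynomialFunctions.starClosure_eq_adjoin_X, ← StarSubalgebra.mem_toSubalgebra,
      StarAlgebra.adjoin_toSubalgebra, ← Subalgebra.mem_toSubmodule, Algebra.adjoin_eq_span,
      Set.star_singleton, Set.singleton_union] at hφ
    induction hφ using Submodule.span_induction with
    | mem φ hφ =>
      obtain ⟨m, k, rfl⟩ := (Submonoid.mem_closure_pair _ _ _).1 hφ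
      rw [hΛ, ← integral_mul_zvar_pow_eq_zero hγ hf h m k]
      refine integral_congr_ae ?_
      filter_upwards [ae_diskMeasure_mem γ] with x hx
      have h2 : (starRingEnd ℂ) (zvar 1 x) = zvar (-1) x := by simp [zvar]
      simp [coe_diskRetract hx, h2]
    | zero => exact map_zero Λ
    | add φ ψ _ _ h1 h2 => rw [map_add, h1, h2, add_zero]
    | smul c φ _ h1 => rw [map_smul, h1, smul_zero]
  have hall : ∀ φ, Λ φ = 0 := by
    intro φ
    have hφ : φ ∈ (polynomialFunctions K).starClosure.topologicalClosure := by
      rw [polynomialFunctions.starClosure_topologicalClosure]; trivial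
    have hcl : IsClosed {φ | Λ φ = 0} := isClosed_eq Λ.continuous continuous_const
    exact closure_minimal (fun φ hφ => hpoly φ hφ) hcl hφ
  refine ae_eq_zero_of_integral_contDiff_smul_eq_zero hf.locallyIntegrable fun g hg _ => ?_
  let φ : C(K, ℂ) := ⟨fun z => (g ((z : ℂ).re, (z : ℂ).im) : ℂ), by
    have := hg.continuous
    fun_prop⟩
  rw [← hall φ, hΛ]
  refine integral_congr_ae ?_
  filter_upwards [ae_diskMeasure_mem γ] with x hx
  simp [φ, coe_diskRetract hx, zvar, mul_comm]

/-- Parseval's identity for the disk polynomials. -/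
lemma hasSum_parseval {γ : ℝ} (hγ : 0 ≤ γ) {f : ℝ × ℝ → ℂ} (hf : MemLp f 2 (diskMeasure γ)) :
    HasSum (fun i : ℕ × ℕ => ‖∫ x, f x * diskPoly 1 γ i.1 i.2 x ∂(diskMeasure γ)‖ ^ 2 /
      dpNormSq γ i.1 i.2) (∫ x, ‖f x‖ ^ 2 ∂(diskMeasure γ)) := by
  have := isFiniteMeasure_diskMeasure hγ
  have hmem : ∀ i : ℕ × ℕ, MemLp (diskPoly 1 γ i.2 i.1) 2 (diskMeasure γ) := by
    intro i
    have hc := (contDiff_diskPoly 1 γ i.2 i.1).continuous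
    obtain ⟨M, -, hM⟩ := exists_bound_on_disk hc
    exact MemLp.of_bound hc.aestronglyMeasurable M
      ((ae_diskMeasure_mem γ).mono fun x hx => hM x hx)
  let e : ℕ × ℕ → Lp ℂ 2 (diskMeasure γ) := fun i =>
    ((√(dpNormSq γ i.1 i.2))⁻¹ : ℂ) • (hmem i).toLp
  have hinner : ∀ (i : ℕ × ℕ) (F : Lp ℂ 2 (diskMeasure γ)), inner ℂ (e i) F =
      ((√(dpNormSq γ i.1 i.2))⁻¹ : ℂ) *
        ∫ x, F x * diskPoly 1 γ i.1 i.2 x ∂(diskMeasure γ) := by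
    intro i F
    rw [inner_smul_left, L2.inner_def]
    congr 1
    · simp
    · refine integral_congr_ae ?_
      filter_upwards [(hmem i).coeFn_toLp] with x hx
      rw [hx, RCLike.inner_apply, conj_diskPoly]
  have hON : Orthonormal ℂ e := by
    rw [orthonormal_iff_ite]
    intro i j
    rw [show e j = ((√(dpNormSq γ j.1 j.2))⁻¹ : ℂ) • (hmem j).toLp from rfl, inner_smul_right,
      hinner]
    have h1 : ∫ x, (hmem j).toLp _ x * diskPoly 1 γ i.1 i.2 x ∂(diskMeasure γ) =
        ∫ x, diskPoly 1 γ j.2 j.1 x * diskPoly 1 γ i.1 i.2 x ∂(diskMeasure γ) := by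
      refine integral_congr_ae ?_
      filter_upwards [(hmem j).coeFn_toLp] with x hx
      rw [hx]
    rw [h1]
    split_ifs with hij
    · subst hij
      rw [integral_diskPoly_mul_self]
      have hp := dpNormSq_pos hγ i.1 i.2
      have h2 : √(dpNormSq γ i.1 i.2) ≠ 0 := (Real.sqrt_pos.2 hp).ne'
      have h3 : √(dpNormSq γ i.1 i.2) * √(dpNormSq γ i.1 i.2) = dpNormSq γ i.1 i.2 :=
        Real.mul_self_sqrt hp.le
      nth_rewrite 3 [← h3]
      push_cast
      have h4 : (√(dpNormSq γ i.1 i.2) : ℂ) ≠ 0 := by exact_mod_cast h2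
      field_simp
    · rw [integral_diskPoly_mul_eq_zero hγ, mul_zero, mul_zero]
      intro heq
      apply hij
      simp only [Prod.mk.injEq] at heq
      exact Prod.ext heq.2.symm heq.1.symm
  have hbot : (Submodule.span ℂ (Set.range e))ᗮ = ⊥ := by
    rw [Submodule.eq_bot_iff]
    intro F hF
    rw [Submodule.mem_orthogonal] at hF
    have hz : ∀ p q, ∫ x, F x * diskPoly 1 γ p q x ∂(diskMeasure γ) = 0 := by
      intro p q
      have h1 := hF (e (p, q)) (Submodule.subset_span ⟨_, rfl⟩)
      rw [hinner] at h1
      refine (mul_eq_zero.1 h1).resolve_left ?_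
      have h2 : √(dpNormSq γ p q) ≠ 0 := (Real.sqrt_pos.2 (dpNormSq_pos hγ p q)).ne'
      exact inv_ne_zero (by exact_mod_cast h2)
    rw [Lp.eq_zero_iff_ae_eq_zero]
    exact ae_eq_zero_of_integral_diskPoly hγ ((Lp.memLp F).integrable (by norm_num)) hz
  let B := HilbertBasis.mkOfOrthogonalEqBot hON hbot
  have hB : ∀ i, B i = e i := fun i => by
    rw [HilbertBasis.coe_mkOfOrthogonalEqBot]
  have hsum := B.hasSum_inner_mul_inner hf.toLp hf.toLp
  have hF : ∀ i : ℕ × ℕ, ∫ x, hf.toLp f x * diskPoly 1 γ i.1 i.2 x ∂(diskMeasure γ) =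
      ∫ x, f x * diskPoly 1 γ i.1 i.2 x ∂(diskMeasure γ) := by
    intro i
    refine integral_congr_ae ?_
    filter_upwards [hf.coeFn_toLp] with x hx
    rw [hx]
  have hterm : ∀ i, inner ℂ hf.toLp (B i) * inner ℂ (B i) hf.toLp =
      ((‖∫ x, f x * diskPoly 1 γ i.1 i.2 x ∂(diskMeasure γ)‖ ^ 2 / dpNormSq γ i.1 i.2 : ℝ) : ℂ) := by
    intro i
    rw [hB, ← inner_conj_symm, Complex.conj_mul', hinner, hF, norm_mul, ← Complex.ofReal_pow, mul_pow,
      norm_inv,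
      Complex.norm_real, Real.norm_eq_abs, inv_pow, sq_abs,
      Real.sq_sqrt (dpNormSq_pos hγ i.1 i.2).le]
    push_cast
    ring
  have htot : inner ℂ hf.toLp hf.toLp = ((∫ x, ‖f x‖ ^ 2 ∂(diskMeasure γ) : ℝ) : ℂ) := by
    rw [L2.inner_def, ← integral_complex_ofReal]
    refine integral_congr_ae ?_
    filter_upwards [hf.coeFn_toLp] with x hx
    rw [hx, RCLike.inner_apply, Complex.mul_conj']
    push_cast
    rfl
  simp only [hterm, htot] at hsum
  exact Complex.hasSum_ofReal.1 hsum

/-! ### Wirtinger combinations of derivatives of a fixed order -/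

/-- If `V j` stands for `∂_x^{a+b-j} ∂_y^j`, then `wirtComb a b V` is the linear combination of
`V 0, …, V (a + b)` that stands for `∂_z^a ∂_z̄^b`. -/
noncomputable def wirtComb : ℕ → ℕ → (ℕ → ℂ) → ℂ
  | 0, 0, V => V 0
  | a + 1, 0, V => wirtComb a 0 fun j => (V j - 1 * Complex.I * V (j + 1)) / 2
  | a, b + 1, V => wirtComb a b fun j => (V j - -1 * Complex.I * V (j + 1)) / 2

lemma wirtComb_succ_right (a b : ℕ) (V : ℕ → ℂ) :
    wirtComb a (b + 1) V = wirtComb a b fun j => (V j - -1 * Complex.I * V (j + 1)) / 2 := by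
  cases a <;> rw [wirtComb]

lemma wirtComb_succ_left (a b : ℕ) (V : ℕ → ℂ) :
    wirtComb (a + 1) b V = wirtComb a b fun j => (V j - 1 * Complex.I * V (j + 1)) / 2 := by
  induction b generalizing V with
  | zero => rw [wirtComb]
  | succ b ih =>
    rw [wirtComb_succ_right, ih, wirtComb_succ_right]
    congr 1
    ext j
    ring

/-- The change from `∂_x, ∂_y` to `∂_z, ∂_z̄` is unitary up to the factor `√2`, hence it preserves
the norm of symmetric tensors of order `s` up to the factor `2^{s/2}`. -/
lemma sum_choose_mul_norm_sq (s : ℕ) (V : ℕ → ℂ) :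
    ∑ k ∈ Finset.HasAntidiagonal.antidiagonal s, (s.choose k.1 : ℝ) * ‖V k.1‖ ^ 2 =
      2 ^ s * ∑ k ∈ Finset.HasAntidiagonal.antidiagonal s, (s.choose k.1 : ℝ) * ‖wirtComb k.2 k.1 V‖ ^ 2 := by
  induction s generalizing V with
  | zero => simp [wirtComb]
  | succ s ih =>
    have hsymm : ∀ g : ℕ × ℕ → ℝ,
        ∑ k ∈ Finset.HasAntidiagonal.antidiagonal s, (s.choose k.2 : ℝ) * g k =
          ∑ k ∈ Finset.HasAntidiagonal.antidiagonal s, (s.choose k.1 : ℝ) * g k := by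
      refine fun g => Finset.sum_congr rfl fun k hk => ?_
      rw [Finset.HasAntidiagonal.mem_antidiagonal] at hk
      rw [← hk, Nat.choose_symm_add]
    rw [Finset.sum_antidiagonal_choose_succ_mul (fun i _ => ‖V i‖ ^ 2),
      Finset.sum_antidiagonal_choose_succ_mul (fun i j => ‖wirtComb j i V‖ ^ 2),
      hsymm fun k => ‖V (k.1 + 1)‖ ^ 2, hsymm fun k => ‖wirtComb k.2 (k.1 + 1) V‖ ^ 2]
    simp only [wirtComb_succ_left, wirtComb_succ_right]
    rw [pow_succ, mul_comm ((2 : ℝ) ^ s), mul_assoc, mul_add ((2 : ℝ) ^ s), ← ih, ← ih,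
      ← Finset.sum_add_distrib, ← Finset.sum_add_distrib, Finset.mul_sum]
    refine Finset.sum_congr rfl fun k _ => ?_
    have hpar := parallelogram_law_with_norm ℝ (V k.1) (Complex.I * V (k.1 + 1))
    rw [norm_mul, Complex.norm_I, one_mul] at hpar
    have e1 : V k.1 - 1 * Complex.I * V (k.1 + 1) = V k.1 - Complex.I * V (k.1 + 1) := by ring
    have e2 : V k.1 - -1 * Complex.I * V (k.1 + 1) = V k.1 + Complex.I * V (k.1 + 1) := by ring
    have n2 : ‖(2 : ℂ)‖ = 2 := by simp
    rw [e1, e2, norm_div, norm_div, n2]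
    linear_combination (-(s.choose k.1 : ℝ) / 2) * hpar

lemma memLp_wirtComb {μ : Measure (ℝ × ℝ)} (a b : ℕ) {v : ℕ → ℝ × ℝ → ℂ}
    (hv : ∀ j, MemLp (v j) 2 μ) : MemLp (fun x => wirtComb a b fun j => v j x) 2 μ := by
  have step : ∀ (σ : ℂ) (v : ℕ → ℝ × ℝ → ℂ), (∀ j, MemLp (v j) 2 μ) → ∀ j,
      MemLp (fun x => (v j x - σ * Complex.I * v (j + 1) x) / 2) 2 μ := by
    intro σ v hv j
    have := ((hv j).sub ((hv (j + 1)).const_mul (σ * Complex.I))).const_mul (1 / 2)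
    refine this.congr_norm ?_ ?_
    · exact (((hv j).sub ((hv (j + 1)).const_mul (σ * Complex.I))).const_mul
        (1 / 2)).aestronglyMeasurable.congr
          (Eventually.of_forall fun x => by simp; ring)
    · refine Eventually.of_forall fun x => ?_
      congr 1
      simp
      ring
  induction b generalizing v with
  | zero =>
    induction a generalizing v with
    | zero => simpa only [wirtComb] using hv 0
    | succ a ih => simpa only [wirtComb] using ih (step 1 v hv)
  | succ b ih => simpa only [wirtComb_succ_right] using ih (step (-1) v hv)

lemma integral_wirtComb_mul {μ : Measure (ℝ × ℝ)} (a b : ℕ) {v : ℕ → ℝ × ℝ → ℂ} {Φ : ℝ × ℝ → ℂ}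
    (hv : ∀ j, Integrable (fun x => v j x * Φ x) μ) :
    ∫ x, (wirtComb a b fun j => v j x) * Φ x ∂μ = wirtComb a b fun j => ∫ x, v j x * Φ x ∂μ := by
  have step : ∀ (σ : ℂ) (v : ℕ → ℝ × ℝ → ℂ), (∀ j, Integrable (fun x => v j x * Φ x) μ) → ∀ j,
      Integrable (fun x => ((v j x - σ * Complex.I * v (j + 1) x) / 2) * Φ x) μ ∧
      ∫ x, ((v j x - σ * Complex.I * v (j + 1) x) / 2) * Φ x ∂μ =
        ((∫ x, v j x * Φ x ∂μ) - σ * Complex.I * ∫ x, v (j + 1) x * Φ x ∂μ) / 2 := by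
    intro σ v hv j
    have hi := (hv j).sub ((hv (j + 1)).const_mul (σ * Complex.I))
    have e : (fun x => ((v j x - σ * Complex.I * v (j + 1) x) / 2) * Φ x) = fun x =>
        (v j x * Φ x - σ * Complex.I * (v (j + 1) x * Φ x)) / 2 := by ext x; ring
    refine ⟨by rw [e]; exact hi.div_const 2, ?_⟩
    rw [e, integral_div, integral_sub (hv j) ((hv (j + 1)).const_mul _), integral_const_mul]
  induction b generalizing v with
  | zero =>
    induction a generalizing v with
    | zero => simp only [wirtComb]
    | succ a ih =>
      simp only [wirtComb]
      rw [ih fun j => (step 1 v hv j).1]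
      simp only [(step 1 v hv _).2]
  | succ b ih =>
    simp only [wirtComb_succ_right]
    rw [ih fun j => (step (-1) v hv j).1]
    simp only [(step (-1) v hv _).2]

/-! ### Weak derivatives tested against complex functions -/

/-- The directional derivative along `v` of a complex-valued function. -/
noncomputable def dirD (v : ℝ × ℝ) (f : ℝ × ℝ → ℂ) : ℝ × ℝ → ℂ := fun x => fderiv ℝ f x v

lemma contDiff_dirD (v : ℝ × ℝ) {f : ℝ × ℝ → ℂ} (hf : ContDiff ℝ ∞ f) :
    ContDiff ℝ ∞ (dirD v f) :=
  (hf.fderiv_right (by simp)).clm_apply contDiff_const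

lemma dirD_comm (v w : ℝ × ℝ) {f : ℝ × ℝ → ℂ} (hf : ContDiff ℝ ∞ f) :
    dirD v (dirD w f) = dirD w (dirD v f) := by
  have hd : Differentiable ℝ (fderiv ℝ f) :=
    (hf.fderiv_right (m := ∞) (by simp)).differentiable (by simp)
  have key : ∀ (v w x), dirD v (dirD w f) x = fderiv ℝ (fderiv ℝ f) x v w := by
    intro v w x
    unfold dirD
    rw [fderiv_clm_apply (hd x) (differentiableAt_const w)]
    simp
  ext x
  rw [key, key]
  exact ((contDiff_infty.1 hf 2).contDiffAt.isSymmSndFDerivAt (by simp)).eq v w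

lemma IsTest.dirD {Φ : ℝ × ℝ → ℂ} (h : IsTest Φ) (v : ℝ × ℝ) : IsTest (dirD v Φ) := by
  have hsub : tsupport (WeightedDisk.dirD v Φ) ⊆ tsupport Φ := tsupport_fderiv_apply_subset ℝ v
  exact ⟨contDiff_dirD v h.contDiff, h.hasCompactSupport.mono' ((subset_tsupport _).trans hsub),
    hsub.trans h.tsupport_subset⟩

lemma IsTest.iterate_dirD {Φ : ℝ × ℝ → ℂ} (h : IsTest Φ) (v : ℝ × ℝ) (n : ℕ) :
    IsTest ((WeightedDisk.dirD v)^[n] Φ) := by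
  induction n generalizing Φ with
  | zero => exact h
  | succ n ih => exact ih (h.dirD v)

lemma iterate_dirD_comm (v w : ℝ × ℝ) (n : ℕ) {Φ : ℝ × ℝ → ℂ} (h : IsTest Φ) :
    (dirD w)^[n] (dirD v Φ) = dirD v ((dirD w)^[n] Φ) := by
  induction n generalizing Φ with
  | zero => rfl
  | succ n ih =>
    rw [Function.iterate_succ_apply, dirD_comm w v h.contDiff, ih (h.dirD w),
      Function.iterate_succ_apply]

lemma iterate_dirD_wirt (v : ℝ × ℝ) (σ : ℂ) (n : ℕ) {F G : ℝ × ℝ → ℂ} (hF : IsTest F)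
    (hG : IsTest G) : (dirD v)^[n] (fun x => (F x - σ * Complex.I * G x) / 2) =
      fun x => ((dirD v)^[n] F x - σ * Complex.I * (dirD v)^[n] G x) / 2 := by
  induction n generalizing F G with
  | zero => rfl
  | succ n ih =>
    have e : dirD v (fun x => (F x - σ * Complex.I * G x) / 2) =
        fun x => (dirD v F x - σ * Complex.I * dirD v G x) / 2 := by
      ext x
      have h1 := (hF.contDiff.differentiable (by simp) x).hasFDerivAt
      have h2 := (hG.contDiff.differentiable (by simp) x).hasFDerivAt
      have h3 := ((h1.sub (h2.const_mul (σ * Complex.I))).mul_const (1 / 2))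
      have h4 : HasFDerivAt (fun x => (F x - σ * Complex.I * G x) / 2) _ x :=
        h3.congr_of_eventuallyEq (Eventually.of_forall fun y => by simp; ring)
      simp only [dirD, h4.fderiv]
      simp
      ring
    rw [Function.iterate_succ_apply, e, ih (hF.dirD v) (hG.dirD v)]
    rfl

lemma iterate_partial_clm (L : ℂ →L[ℝ] ℝ) (i j : ℕ) {Φ : ℝ × ℝ → ℂ} (h : IsTest Φ) :
    partialX^[i] (partialY^[j] fun x => L (Φ x)) =
      fun x => L ((dirD (1, 0))^[i] ((dirD (0, 1))^[j] Φ) x) := by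
  have h1 : ∀ (v : ℝ × ℝ) (Ψ : ℝ × ℝ → ℂ), IsTest Ψ →
      (fun x => fderiv ℝ (fun y => L (Ψ y)) x v) = fun x => L (dirD v Ψ x) := by
    intro v Ψ hΨ
    ext x
    have h2 : HasFDerivAt (fun y => L (Ψ y)) (L.comp (fderiv ℝ Ψ x)) x :=
      L.hasFDerivAt.comp x (hΨ.contDiff.differentiable (by simp) x).hasFDerivAt
    rw [h2.fderiv]
    rfl
  have hy : partialY^[j] (fun x => L (Φ x)) = fun x => L ((dirD (0, 1))^[j] Φ x) := by
    induction j generalizing Φ with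
    | zero => rfl
    | succ j ih =>
      rw [Function.iterate_succ_apply]
      unfold partialY at ih ⊢
      rw [h1 _ _ h, ih (h.dirD _)]
      rfl
  rw [hy]
  have h' := h.iterate_dirD (0, 1) j
  generalize (dirD (0, 1))^[j] Φ = Ψ at h'
  induction i generalizing Ψ with
  | zero => rfl
  | succ i ih =>
    rw [Function.iterate_succ_apply]
    unfold partialX at ih ⊢
    rw [h1 _ _ h', ih _ (h'.dirD _)]
    rfl

lemma IsTest.integrableOn_mul {Φ : ℝ × ℝ → ℂ} (h : IsTest Φ) {u : ℝ × ℝ → ℝ}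
    (hu : LocallyIntegrableOn u disk) : IntegrableOn (fun x => (u x : ℂ) * Φ x) disk := by
  have hK : IsCompact (tsupport Φ) := h.hasCompactSupport
  have h1 : IntegrableOn u (tsupport Φ) := hu.integrableOn_compact_subset h.tsupport_subset hK
  have h2 : IntegrableOn (fun x => (u x : ℂ)) (tsupport Φ) := h1.ofReal
  have h3 := h2.mul_continuousOn h.contDiff.continuous.continuousOn hK
  rw [integrableOn_iff_integrable_of_support_subset] at h3
  · exact h3.integrableOn
  · intro x hx
    exact subset_tsupport _ (right_ne_zero_of_mul hx)

lemma IsTest.comp_clm {Φ : ℝ × ℝ → ℂ} (h : IsTest Φ) (L : ℂ →L[ℝ] ℝ) :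
    ContDiff ℝ ∞ (fun x => L (Φ x)) ∧ HasCompactSupport (fun x => L (Φ x)) ∧
      tsupport (fun x => L (Φ x)) ⊆ disk := by
  have hs : Function.support (fun x => L (Φ x)) ⊆ Function.support Φ := by
    intro x hx h0
    exact hx (by simp [h0])
  exact ⟨L.contDiff.comp h.contDiff, h.hasCompactSupport.mono hs,
    (closure_mono hs).trans h.tsupport_subset⟩

lemma IsWeakDeriv.integral_mul {i j : ℕ} {u v : ℝ × ℝ → ℝ} (h : IsWeakDeriv i j u v)
    {Φ : ℝ × ℝ → ℂ} (hΦ : IsTest Φ) :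
    ∫ x in disk, (u x : ℂ) * (dirD (1, 0))^[i] ((dirD (0, 1))^[j] Φ) x =
      (-1) ^ (i + j) * ∫ x in disk, (v x : ℂ) * Φ x := by
  have hΨ := (hΦ.iterate_dirD (0, 1) j).iterate_dirD (1, 0) i
  have h1 := hΨ.integrableOn_mul h.1
  have h2 := hΦ.integrableOn_mul h.2.1
  have e : ((-1 : ℂ)) ^ (i + j) = (((-1 : ℝ) ^ (i + j) : ℝ) : ℂ) := by push_cast; rfl
  have key : ∀ L : ℂ →L[ℝ] ℝ, L (∫ x in disk, (u x : ℂ) *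
      (dirD (1, 0))^[i] ((dirD (0, 1))^[j] Φ) x) =
      (-1) ^ (i + j) * L (∫ x in disk, (v x : ℂ) * Φ x) := by
    intro L
    obtain ⟨c1, c2, c3⟩ := hΦ.comp_clm L
    have h3 := h.2.2 _ c1 c2 c3
    rw [iterate_partial_clm L i j hΦ] at h3
    rw [← L.integral_comp_comm h1, ← L.integral_comp_comm h2]
    have hL : ∀ (r : ℝ) (z : ℂ), L (r * z) = r * L z := fun r z => by
      rw [← Complex.real_smul, map_smul, smul_eq_mul]
    simpa only [hL] using h3
  rw [e]
  apply Complex.ext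
  · rw [Complex.re_ofReal_mul]; exact key Complex.reCLM
  · rw [Complex.im_ofReal_mul]; exact key Complex.imCLM

/-- Weak derivatives are unique almost everywhere, so that `weakDeriv` inherits the integrability of any
other representative. -/
lemma IsWeakDeriv.ae_eq {i j : ℕ} {u v v' : ℝ × ℝ → ℝ} (h : IsWeakDeriv i j u v)
    (h' : IsWeakDeriv i j u v') (γ : ℝ) : v =ᵐ[diskMeasure γ] v' := by
  have h1 : ∀ᵐ x ∂(volume : Measure (ℝ × ℝ)), x ∈ disk → (v - v') x = 0 := by
    refine isOpen_disk.ae_eq_zero_of_integral_contDiff_smul_eq_zero (h.2.1.sub h'.2.1)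
      fun g hg hc hs => ?_
    have hT : IsTest fun x => (g x : ℂ) := by
      have hsupp : Function.support (fun x => (g x : ℂ)) ⊆ Function.support g := by
        intro x hx h0
        exact hx (by simp [h0])
      exact ⟨Complex.ofRealCLM.contDiff.comp hg, hc.mono hsupp, (closure_mono hsupp).trans hs⟩
    have e1 := h.2.2 g hg hc hs
    have e2 := h'.2.2 g hg hc hs
    have e3 : ∫ x in disk, v x * g x = ∫ x in disk, v' x * g x :=
      mul_left_cancel₀ (pow_ne_zero _ (by norm_num)) (e1.symm.trans e2)
    have hi : ∀ {w : ℝ × ℝ → ℝ}, LocallyIntegrableOn w disk →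
        IntegrableOn (fun x => w x * g x) disk := by
      intro w hw
      have : Integrable (fun x => RCLike.re ((w x : ℂ) * (g x : ℂ))) (volume.restrict disk) :=
        (hT.integrableOn_mul hw).re
      simpa [IntegrableOn] using this
    have hz : ∫ x, g x • (v - v') x = ∫ x in disk, (v x * g x - v' x * g x) := by
      rw [← setIntegral_eq_integral_of_forall_compl_eq_zero (s := disk)]
      · congr 1; ext x; simp; ring
      · intro x hx
        have : g x = 0 := image_eq_zero_of_notMem_tsupport fun h' => hx (hs h')
        simp [this]
    rw [hz, integral_sub (hi h.2.1) (hi h'.2.1), e3, sub_self]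
  refine (withDensity_absolutelyContinuous _ _).ae_le ?_
  refine (ae_restrict_iff' isOpen_disk.measurableSet).2 ?_
  filter_upwards [h1] with x hx hxd
  exact sub_eq_zero.1 (hx hxd)

/-- The combinations `wirtComb` turn iterated partial derivatives of a test function into iterated
Wirtinger derivatives. -/
lemma wirtComb_eq_integral {u : ℝ × ℝ → ℝ} (hu : LocallyIntegrableOn u disk) (a b : ℕ)
    {Φ : ℝ × ℝ → ℂ} (hΦ : IsTest Φ) {V : ℕ → ℂ}
    (hV : ∀ j ≤ a + b, V j = ∫ x in disk, (u x : ℂ) *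
      (dirD (1, 0))^[a + b - j] ((dirD (0, 1))^[j] Φ) x) :
    wirtComb a b V = ∫ x in disk, (u x : ℂ) * (wirt 1)^[a] ((wirt (-1))^[b] Φ) x := by
  have step : ∀ (σ : ℂ) (N : ℕ) {Φ : ℝ × ℝ → ℂ} (hΦ : IsTest Φ) {V : ℕ → ℂ}
      (hV : ∀ j ≤ N + 1, V j = ∫ x in disk, (u x : ℂ) *
        (dirD (1, 0))^[N + 1 - j] ((dirD (0, 1))^[j] Φ) x),
      ∀ j ≤ N, (V j - σ * Complex.I * V (j + 1)) / 2 = ∫ x in disk, (u x : ℂ) *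
        (dirD (1, 0))^[N - j] ((dirD (0, 1))^[j] (wirt σ Φ)) x := by
    intro σ N Φ hΦ V hV j hj
    have h1 := (hΦ.iterate_dirD (0, 1) j).iterate_dirD (1, 0) (N + 1 - j)
    have h2 := (hΦ.iterate_dirD (0, 1) (j + 1)).iterate_dirD (1, 0) (N - j)
    have e : (dirD (1, 0))^[N - j] ((dirD (0, 1))^[j] (wirt σ Φ)) = fun x =>
        ((dirD (1, 0))^[N + 1 - j] ((dirD (0, 1))^[j] Φ) x - σ * Complex.I *
          (dirD (1, 0))^[N - j] ((dirD (0, 1))^[j + 1] Φ) x) / 2 := by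
      have e0 : wirt σ Φ = fun x =>
          (dirD (1, 0) Φ x - σ * Complex.I * dirD (0, 1) Φ x) / 2 := rfl
      rw [e0, iterate_dirD_wirt _ _ _ (hΦ.dirD _) (hΦ.dirD _),
        iterate_dirD_wirt _ _ _ ((hΦ.dirD _).iterate_dirD _ _) ((hΦ.dirD _).iterate_dirD _ _),
        iterate_dirD_comm _ _ _ hΦ, ← Function.iterate_succ_apply,
        show (N - j).succ = N + 1 - j by omega]
      rfl
    rw [hV j (by omega), hV (j + 1) (by omega), show N + 1 - (j + 1) = N - j by omega, e,
      ← integral_const_mul, ← integral_sub (h1.integrableOn_mul hu)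
      ((h2.integrableOn_mul hu).const_mul _), ← integral_div]
    congr 1
    ext x
    ring
  induction b generalizing Φ V with
  | zero =>
    induction a generalizing Φ V with
    | zero => simpa [wirtComb] using hV 0 le_rfl
    | succ a ih =>
      rw [wirtComb_succ_left, ih (hΦ.wirt 1) (step 1 a hΦ hV)]
      rfl
  | succ b ih =>
    rw [wirtComb_succ_right, ih (hΦ.wirt (-1)) (step (-1) (a + b) hΦ hV)]
    rfl

/-! ### The seminorm as a series of coefficients -/

/-- The contribution `|∫ u Z|² / ‖Z‖²` of the disk polynomial `Z` of bidegree `(P, Q)` to the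
squared norm of `u`. -/
noncomputable def dpTerm (γ : ℝ) (u : ℝ × ℝ → ℝ) (i : ℕ × ℕ) : ℝ :=
  ‖∫ x, (u x : ℂ) * diskPoly 1 γ i.1 i.2 x ∂(diskMeasure γ)‖ ^ 2 / dpNormSq γ i.1 i.2

/-- The weights of the contributions `dpTerm` in the seminorm. -/
noncomputable def lamSum (γ : ℝ) (s : ℕ) (i : ℕ × ℕ) : ℝ :=
  ∑ k ∈ Finset.HasAntidiagonal.antidiagonal s, (s.choose k.1 : ℝ) * lam γ k.2 k.1 i.1 i.2

lemma wNorm_sq {γ : ℝ} (f : ℝ × ℝ → ℝ) : wNorm γ f ^ 2 = ∫ x, f x ^ 2 ∂(diskMeasure γ) := by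
  have h : wInner γ f f = ∫ x, f x ^ 2 ∂(diskMeasure γ) := by
    unfold wInner; congr 1; ext x; ring
  rw [wNorm, Real.sq_sqrt, h]
  rw [h]
  exact integral_nonneg fun x => by positivity

/-- Parseval's identity for `∂_z^a ∂_z̄^b u`, in terms of the coefficients of `u`. -/
lemma hasSum_wirtComb {γ : ℝ} (hγ : 0 ≤ γ) {a b s : ℕ} (hs : a + b = s) {u : ℝ × ℝ → ℝ}
    (hu : MemL2 γ u) {v : ℕ → ℝ × ℝ → ℝ} (hv : ∀ j ≤ s, IsWeakDeriv (s - j) j u (v j))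
    (hv2 : ∀ j, MemL2 (γ + s) (v j)) (hv0 : ∀ j, s < j → v j = 0) :
    HasSum (fun i : ℕ × ℕ => lam γ a b i.1 i.2 * dpTerm γ u i)
      (∫ x, ‖wirtComb a b fun j => (v j x : ℂ)‖ ^ 2 ∂(diskMeasure (γ + s))) := by
  subst hs
  have hfin := isFiniteMeasure_diskMeasure hγ
  have hγs : 0 ≤ γ + (a + b : ℕ) := by positivity
  have hfin' := isFiniteMeasure_diskMeasure hγs
  have hw : MemLp (fun x => wirtComb a b fun j => (v j x : ℂ)) 2 (diskMeasure (γ + (a + b : ℕ))) :=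
    memLp_wirtComb a b (v := fun j x => (v j x : ℂ)) fun j => (hv2 j).ofReal
  have huc : MemLp (fun x => (u x : ℂ)) 2 (diskMeasure γ) := MemLp.ofReal hu
  have hlu : LocallyIntegrableOn u disk := (hv 0 (Nat.zero_le _)).1
  have hpair := fun p q => pairing hγ a b p q (huc.integrable (by norm_num))
    (hw.integrable (by norm_num)) (fun Φ hΦ => by
      have hint : ∀ j, Integrable (fun x => (v j x : ℂ) * Φ x) (volume.restrict disk) := by
        intro j
        rcases le_or_gt j (a + b) with hj | hj
        · exact hΦ.integrableOn_mul (hv j hj).2.1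
        · simp [hv0 j hj]
      rw [integral_wirtComb_mul a b (v := fun j x => (v j x : ℂ)) hint]
      have hmul : ∀ (c : ℂ) (a b : ℕ) (V : ℕ → ℂ),
          c * wirtComb a b V = wirtComb a b fun j => c * V j := by
        intro c a b
        induction b with
        | zero =>
          induction a with
          | zero => intro V; simp only [wirtComb]
          | succ a ih => intro V; simp only [wirtComb, ih]; congr 1; ext j; ring
        | succ b ih => intro V; simp only [wirtComb_succ_right, ih]; congr 1; ext j; ring
      rw [hmul]
      refine (wirtComb_eq_integral hlu a b hΦ fun j hj => ?_).symm
      rw [(hv j hj).integral_mul hΦ, Nat.sub_add_cancel hj])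
  have hsum := hasSum_parseval hγs hw
  simp only [hpair] at hsum
  -- the squared norms change by the same factor as the coefficients
  have hterm : ∀ i : ℕ × ℕ, ‖(lam γ a b (i.1 + b) (i.2 + a) : ℂ) *
      ∫ x, (u x : ℂ) * diskPoly 1 γ (i.1 + b) (i.2 + a) x ∂(diskMeasure γ)‖ ^ 2 /
        dpNormSq (γ + (a + b : ℕ)) i.1 i.2 =
      lam γ a b (i.1 + b) (i.2 + a) * dpTerm γ u (i.1 + b, i.2 + a) := by
    intro i
    have h1 : 0 < lam γ a b (i.1 + b) (i.2 + a) := lam_pos hγ (by omega) (by omega)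
    have h2 := dpNormSq_pos hγ (i.1 + b) (i.2 + a)
    rw [dpNormSq_eq_lam_mul hγ, norm_mul, Complex.norm_real, Real.norm_eq_abs, mul_pow, sq_abs,
      dpTerm]
    field_simp
  simp only [hterm] at hsum
  have hinj : Function.Injective fun i : ℕ × ℕ => (i.1 + b, i.2 + a) := by
    intro i j hij
    simp only [Prod.mk.injEq] at hij
    exact Prod.ext (by omega) (by omega)
  refine (hinj.hasSum_iff fun i hi => ?_).1 hsum
  have hlt : i.1 < b ∨ i.2 < a := by
    by_contra hcon
    push Not at hcon
    exact hi ⟨(i.1 - b, i.2 - a), Prod.ext (Nat.sub_add_cancel hcon.1) (Nat.sub_add_cancel hcon.2)⟩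
  have : lam γ a b i.1 i.2 = 0 := by
    rcases hlt with h | h <;> simp [lam, Nat.descFactorial_eq_zero_iff_lt.2 h]
  rw [this, zero_mul]

lemma hasSum_sobolevSeminorm {γ : ℝ} (hγ : 0 ≤ γ) {s : ℕ} {u : ℝ × ℝ → ℝ}
    (hu : MemSobolev γ s u) :
    HasSum (fun i : ℕ × ℕ => 2 ^ s * (lamSum γ s i * dpTerm γ u i))
      (sobolevSeminorm γ s u ^ 2) := by
  obtain ⟨hu2, hu⟩ := hu
  let v : ℕ → ℝ × ℝ → ℝ := fun j => if j ≤ s then weakDeriv (s - j) j u else 0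
  have hwd : ∀ j ≤ s, IsWeakDeriv (s - j) j u (weakDeriv (s - j) j u) := by
    intro j hj
    have hex : ∃ v, IsWeakDeriv (s - j) j u v := (hu j hj).imp fun _ h => h.1
    rw [weakDeriv, dif_pos hex]
    exact hex.choose_spec
  have hv : ∀ j ≤ s, IsWeakDeriv (s - j) j u (v j) := by
    intro j hj
    simpa only [v, if_pos hj] using hwd j hj
  have hv2 : ∀ j, MemL2 (γ + s) (v j) := by
    intro j
    by_cases hj : j ≤ s
    · obtain ⟨v', h1, h2⟩ := hu j hj
      exact MemLp.ae_eq (h1.ae_eq (hv j hj) _) h2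
    · simp only [v, if_neg hj]
      exact MemLp.zero'
  have hv0 : ∀ j, s < j → v j = 0 := fun j hj => by simp [v, not_le.2 hj]
  have hfin := isFiniteMeasure_diskMeasure (γ := γ + s) (by positivity)
  have hsemi : sobolevSeminorm γ s u ^ 2 = ∑ k ∈ Finset.HasAntidiagonal.antidiagonal s,
      2 ^ s * ((s.choose k.1 : ℝ) *
        ∫ x, ‖wirtComb k.2 k.1 fun j => (v j x : ℂ)‖ ^ 2 ∂(diskMeasure (γ + s))) := by
    have hmem : ∀ a b, MemLp (fun x => wirtComb a b fun j => (v j x : ℂ)) 2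
        (diskMeasure (γ + s)) := fun a b =>
      memLp_wirtComb a b (v := fun j x => (v j x : ℂ)) fun j => (hv2 j).ofReal
    rw [sobolevSeminorm, Real.sq_sqrt (Finset.sum_nonneg fun j _ => by positivity)]
    have e1 : ∑ j ∈ Finset.range (s + 1), (s.choose j : ℝ) *
        wNorm (γ + s) (weakDeriv (s - j) j u) ^ 2 =
        ∑ k ∈ Finset.HasAntidiagonal.antidiagonal s, (s.choose k.1 : ℝ) *
          ∫ x, ‖(v k.1 x : ℂ)‖ ^ 2 ∂(diskMeasure (γ + s)) := by
      rw [Finset.Nat.sum_antidiagonal_eq_sum_range_succ_mk]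
      refine Finset.sum_congr rfl fun j hj => ?_
      have hj' : j ≤ s := by simpa [Nat.lt_succ_iff] using hj
      rw [wNorm_sq]
      simp only [v, if_pos hj', Complex.norm_real, Real.norm_eq_abs, sq_abs]
    rw [e1]
    simp only [← integral_const_mul]
    rw [← integral_finsetSum, ← integral_finsetSum]
    · congr 1
      ext x
      rw [sum_choose_mul_norm_sq s fun j => (v j x : ℂ), Finset.mul_sum]
    · exact fun k _ => (((hmem k.2 k.1).integrable_norm_pow (by norm_num)).const_mul _).const_mul _
    · exact fun k _ => (((hv2 k.1).ofReal (K := ℂ)).integrable_norm_pow (by norm_num)).const_mul _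
  rw [hsemi]
  have hall := hasSum_sum (s := Finset.HasAntidiagonal.antidiagonal s) fun k hk =>
    ((hasSum_wirtComb hγ (by rw [Finset.HasAntidiagonal.mem_antidiagonal] at hk; omega : k.2 + k.1 = s) hu2 hv hv2
      hv0).mul_left (s.choose k.1 : ℝ)).mul_left ((2 : ℝ) ^ s)
  refine hall.congr_fun ?_
  intro i
  simp only [lamSum, Finset.sum_mul, Finset.mul_sum, mul_assoc]

/-! ### Bounds for the weights -/

lemma lamSum_eq_zero {γ : ℝ} {s : ℕ} {i : ℕ × ℕ} (h : i.1 + i.2 < s) : lamSum γ s i = 0 := by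
  refine Finset.sum_eq_zero fun k hk => ?_
  rw [Finset.HasAntidiagonal.mem_antidiagonal] at hk
  have : i.1 < k.1 ∨ i.2 < k.2 := by omega
  rcases this with h | h <;> simp [lam, Nat.descFactorial_eq_zero_iff_lt.2 h]

lemma lam_nonneg {γ : ℝ} (hγ : 0 ≤ γ) (a b P Q : ℕ) : 0 ≤ lam γ a b P Q := by
  unfold lam
  have h3 : 0 ≤ ∏ i ∈ Finset.range b, ((Q : ℝ) + γ + 1 + i) :=
    Finset.prod_nonneg fun i _ => by positivity
  have h4 : 0 ≤ ∏ i ∈ Finset.range a, ((P : ℝ) + γ + 1 + i) :=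
    Finset.prod_nonneg fun i _ => by positivity
  positivity

lemma descFactorial_mul_prod_le {γ : ℝ} (hγ : 0 ≤ γ) {s b : ℕ} (hb : b ≤ s) (P Q : ℕ) :
    (P.descFactorial b : ℝ) * ∏ i ∈ Finset.range b, ((Q : ℝ) + γ + 1 + i) ≤
      (((P : ℝ) + 1) * ((Q + 1) * (1 + γ + s))) ^ b := by
  have h1 : (P.descFactorial b : ℝ) ≤ ((P : ℝ) + 1) ^ b := by
    calc (P.descFactorial b : ℝ) ≤ (P : ℝ) ^ b := by exact_mod_cast Nat.descFactorial_le_pow P b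
      _ ≤ ((P : ℝ) + 1) ^ b := by gcongr; linarith
  have h2 : ∏ i ∈ Finset.range b, ((Q : ℝ) + γ + 1 + i) ≤ ((Q + 1) * (1 + γ + s)) ^ b := by
    calc ∏ i ∈ Finset.range b, ((Q : ℝ) + γ + 1 + i)
        ≤ ∏ _i ∈ Finset.range b, (((Q : ℝ) + 1) * (1 + γ + s)) := by
          refine Finset.prod_le_prod (fun i _ => by positivity) fun i hi => ?_
          have hi' : (i : ℝ) ≤ s := by
            have := Finset.mem_range.1 hi
            exact_mod_cast (this.le.trans hb)
          have : 0 ≤ (Q : ℝ) * (γ + s) := by positivity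
          nlinarith
      _ = _ := by simp
  rw [mul_pow]
  exact mul_le_mul h1 h2 (Finset.prod_nonneg fun i _ => by positivity) (by positivity)

lemma lamSum_le {γ : ℝ} (hγ : 0 ≤ γ) (s : ℕ) (i : ℕ × ℕ) :
    lamSum γ s i ≤ (∑ k ∈ Finset.HasAntidiagonal.antidiagonal s, (s.choose k.1 : ℝ)) *
      (1 + γ + s) ^ s * (((i.1 : ℝ) + 1) ^ s * ((i.2 : ℝ) + 1) ^ s) := by
  unfold lamSum
  rw [mul_assoc, Finset.sum_mul]
  refine Finset.sum_le_sum fun k hk => ?_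
  rw [Finset.HasAntidiagonal.mem_antidiagonal] at hk
  gcongr
  calc lam γ k.2 k.1 i.1 i.2
      ≤ (((i.1 : ℝ) + 1) * ((i.2 + 1) * (1 + γ + s))) ^ k.1 *
        (((i.2 : ℝ) + 1) * ((i.1 + 1) * (1 + γ + s))) ^ k.2 := by
        unfold lam
        have h4 : 0 ≤ ∏ j ∈ Finset.range k.2, ((i.1 : ℝ) + γ + 1 + j) :=
          Finset.prod_nonneg fun j _ => by positivity
        exact mul_le_mul (descFactorial_mul_prod_le hγ (by omega) _ _)
          (descFactorial_mul_prod_le hγ (by omega) _ _) (by positivity) (by positivity)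
    _ = ((1 + γ + s) * (((i.1 : ℝ) + 1) * ((i.2 : ℝ) + 1))) ^ (k.1 + k.2) := by
        rw [pow_add]; congr 2 <;> ring
    _ = (1 + γ + s) ^ s * (((i.1 : ℝ) + 1) ^ s * ((i.2 : ℝ) + 1) ^ s) := by
        rw [hk, mul_pow, mul_pow]

lemma pow_le_prod {γ : ℝ} (hγ : 0 ≤ γ) (Q b : ℕ) :
    ((Q : ℝ) + 1) ^ b ≤ ∏ i ∈ Finset.range b, ((Q : ℝ) + γ + 1 + i) := by
  calc ((Q : ℝ) + 1) ^ b = ∏ _i ∈ Finset.range b, ((Q : ℝ) + 1) := by simp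
    _ ≤ _ := by
      refine Finset.prod_le_prod (fun i _ => by positivity) fun i _ => ?_
      have : (0 : ℝ) ≤ i := i.cast_nonneg
      linarith

lemma pow_le_mul_descFactorial {s P : ℕ} (h : s ≤ P) :
    ((P : ℝ) + 1) ^ s ≤ ((s : ℝ) + 1) ^ s * (P.descFactorial s : ℝ) := by
  have h1 : (P + 1 - s) ^ s ≤ P.descFactorial s := Nat.pow_sub_le_descFactorial P s
  have h2 : P + 1 ≤ (s + 1) * (P + 1 - s) := by
    obtain ⟨d, rfl⟩ := Nat.exists_eq_add_of_le h
    rw [show s + d + 1 - s = d + 1 by omega]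
    nlinarith [Nat.zero_le (s * d)]
  have h3 : (P + 1) ^ s ≤ (s + 1) ^ s * P.descFactorial s :=
    (Nat.pow_le_pow_left h2 s).trans (by rw [mul_pow]; exact Nat.mul_le_mul_left _ h1)
  exact_mod_cast h3

/-- One summand of `lamSum` already dominates: `∂_z̄^s` or `∂_z^s` if one of the degrees is at least
`s`, and any derivative that does not vanish if both are small. -/
lemma le_lamSum {γ : ℝ} (hγ : 0 ≤ γ) {s : ℕ} {i : ℕ × ℕ} (h : s ≤ i.1 + i.2) :
    ((i.1 : ℝ) + 1) ^ s * ((i.2 : ℝ) + 1) ^ s ≤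
      (((s : ℝ) + 1) ^ s * ((s : ℝ) + 1) ^ s) * lamSum γ s i := by
  obtain ⟨P, Q⟩ := i
  simp only at h ⊢
  have hs1 : (1 : ℝ) ≤ ((s : ℝ) + 1) ^ s := one_le_pow₀ (by linarith [s.cast_nonneg (α := ℝ)])
  have hterm : ∀ b ≤ s, lam γ (s - b) b P Q ≤ lamSum γ s (P, Q) := by
    intro b hb
    have hmem : (b, s - b) ∈ Finset.HasAntidiagonal.antidiagonal s := by
      rw [Finset.HasAntidiagonal.mem_antidiagonal]; omega
    refine le_trans ?_ (Finset.single_le_sum (f := fun k : ℕ × ℕ =>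
      (s.choose k.1 : ℝ) * lam γ k.2 k.1 P Q)
      (fun k _ => mul_nonneg (Nat.cast_nonneg _) (lam_nonneg hγ _ _ _ _)) hmem)
    refine le_mul_of_one_le_left (lam_nonneg hγ _ _ _ _) ?_
    exact_mod_cast Nat.choose_pos hb
  have hfac : ∀ A B c : ℕ, c ≤ A →
      (1 : ℝ) ≤ (A.descFactorial c : ℝ) * ∏ j ∈ Finset.range c, ((B : ℝ) + γ + 1 + j) := by
    intro A B c hc
    have h1 : (1 : ℝ) ≤ A.descFactorial c := by exact_mod_cast Nat.descFactorial_pos.2 hc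
    have h2 : (1 : ℝ) ≤ ∏ j ∈ Finset.range c, ((B : ℝ) + γ + 1 + j) :=
      (one_le_pow₀ (by linarith [B.cast_nonneg (α := ℝ)])).trans (pow_le_prod hγ B c)
    nlinarith
  have hbig : ∀ A B : ℕ, s ≤ A → ((A : ℝ) + 1) ^ s * ((B : ℝ) + 1) ^ s ≤
      (((s : ℝ) + 1) ^ s * ((s : ℝ) + 1) ^ s) *
        ((A.descFactorial s : ℝ) * ∏ j ∈ Finset.range s, ((B : ℝ) + γ + 1 + j)) := by
    intro A B hA
    have h1 := pow_le_mul_descFactorial hA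
    have h2 := pow_le_prod hγ B s
    calc ((A : ℝ) + 1) ^ s * ((B : ℝ) + 1) ^ s
        ≤ (((s : ℝ) + 1) ^ s * (A.descFactorial s : ℝ)) *
          ∏ j ∈ Finset.range s, ((B : ℝ) + γ + 1 + j) :=
          mul_le_mul h1 h2 (by positivity) (by positivity)
      _ = ((s : ℝ) + 1) ^ s * ((A.descFactorial s : ℝ) *
          ∏ j ∈ Finset.range s, ((B : ℝ) + γ + 1 + j)) := by ring
      _ ≤ _ := by
          refine mul_le_mul_of_nonneg_right (by nlinarith) ?_
          exact mul_nonneg (Nat.cast_nonneg _) (Finset.prod_nonneg fun j _ => by positivity)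
  rcases le_or_gt s P with hP | hP
  · refine (hbig P Q hP).trans (mul_le_mul_of_nonneg_left ?_ (by positivity))
    have := hterm s le_rfl
    simpa [lam] using this
  rcases le_or_gt s Q with hQ | hQ
  · have h1 := hbig Q P hQ
    rw [mul_comm (((Q : ℝ) + 1) ^ s)] at h1
    refine h1.trans (mul_le_mul_of_nonneg_left ?_ (by positivity))
    have := hterm 0 (Nat.zero_le _)
    simpa [lam] using this
  · have h1 : (1 : ℝ) ≤ lamSum γ s (P, Q) := by
      refine le_trans ?_ (hterm P hP.le)
      have h2 := hfac P Q P le_rfl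
      have h3 := hfac Q P (s - P) (by omega)
      unfold lam
      nlinarith
    have hP' : (P : ℝ) ≤ s := by exact_mod_cast hP.le
    have hQ' : (Q : ℝ) ≤ s := by exact_mod_cast hQ.le
    calc ((P : ℝ) + 1) ^ s * ((Q : ℝ) + 1) ^ s ≤ ((s : ℝ) + 1) ^ s * ((s : ℝ) + 1) ^ s := by
          gcongr
      _ ≤ _ := le_mul_of_one_le_right (by positivity) h1

/-! ### The real basis functions -/

lemma zvar_one (x : ℝ × ℝ) : zvar 1 x = (⟨x.1, x.2⟩ : ℂ) := by
  apply Complex.ext <;> simp [zvar]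

/-- Up to a constant, `z^l P_n^{(γ,l)}(2r² - 1)` is the disk polynomial of bidegree `(n + l, n)`. -/
lemma zvar_pow_mul_jacobiP (γ : ℝ) (n l : ℕ) (x : ℝ × ℝ) :
    zvar 1 x ^ l * (jacobiP n γ l (2 * (x.1 ^ 2 + x.2 ^ 2) - 1) : ℂ) =
      ((Real.Gamma (n + 1 + l) / Real.Gamma (n + 1 + γ + l) : ℝ) : ℂ) *
        diskPoly 1 γ (n + l) n x := by
  have hr : ((x.1 ^ 2 + x.2 ^ 2 : ℝ) : ℂ) = zvar 1 x * zvar (-1) x := by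
    have h := bdist_eq_zvar one_sq' x
    simp only [bdist] at h
    push_cast at h ⊢
    linear_combination -h
  have hterm : ∀ j ∈ Finset.range (n + 1),
      zvar 1 x ^ l * (((-1) ^ n * (Real.Gamma (n + 1 + l) / (n.factorial *
        Real.Gamma (n + 1 + γ + l))) * ((-1) ^ j * (2 ^ j)⁻¹ * (n.choose j : ℝ) *
        (Real.Gamma (n + j + 1 + γ + l) / Real.Gamma (j + 1 + l)) *
        (1 + (2 * (x.1 ^ 2 + x.2 ^ 2) - 1)) ^ j) : ℝ) : ℂ) =
      ((Real.Gamma (n + 1 + l) / Real.Gamma (n + 1 + γ + l) : ℝ) : ℂ) *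
        (dpCoeff γ (n + l + n) (n - j) *
          (divPow 1 (n + l) (n - j) x * divPow (-1) n (n - j) x)) := by
    intro j hj
    obtain ⟨d, rfl⟩ : ∃ d, n = j + d :=
      ⟨n - j, by have := Finset.mem_range.1 hj; omega⟩
    have e1 : j + d - j = d := by omega
    have e2 : d ≤ j + d + l := by omega
    have e3 : d ≤ j + d := by omega
    have e4 : j + d + l - d = l + j := by omega
    have e5 : j + d - d = j := by omega
    have hG1 : Real.Gamma ((j : ℝ) + 1 + l) = ((l + j).factorial : ℝ) := by
      rw [← Real.Gamma_nat_eq_factorial]; push_cast; ring_nf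
    have hG2 : Real.Gamma (((j + d + l + (j + d) : ℕ) : ℝ) + γ + 1 - d) =
        Real.Gamma (((j + d : ℕ) : ℝ) + j + 1 + γ + l) := by
      push_cast; ring_nf
    have hch : ((j + d).choose j : ℝ) = (j + d).factorial / (j.factorial * d.factorial) := by
      rw [Nat.cast_add_choose]
    have hx : 1 + (2 * (x.1 ^ 2 + x.2 ^ 2) - 1) = 2 * (x.1 ^ 2 + x.2 ^ 2) := by ring
    have hsgn : (-1 : ℂ) ^ (j + d) * (-1) ^ j = (-1) ^ d := by
      rw [pow_add, mul_right_comm, ← mul_pow]; norm_num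
    have f1 : (j.factorial : ℂ) ≠ 0 := by exact_mod_cast j.factorial_ne_zero
    have f2 : (d.factorial : ℂ) ≠ 0 := by exact_mod_cast d.factorial_ne_zero
    have f3 : ((j + d).factorial : ℂ) ≠ 0 := by exact_mod_cast (j + d).factorial_ne_zero
    have f4 : ((l + j).factorial : ℂ) ≠ 0 := by exact_mod_cast (l + j).factorial_ne_zero
    have hpow : zvar 1 x ^ l * ((x.1 ^ 2 + x.2 ^ 2 : ℝ) : ℂ) ^ j =
        zvar 1 x ^ (l + j) * zvar (-1) x ^ j := by
      rw [hr, mul_pow, pow_add]; ring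
    simp only [dpCoeff, divPow, e1, e2, e3, e4, e5, if_true, hG1, hG2, hch, hx, mul_pow]
    set G := Real.Gamma (((j + d : ℕ) : ℝ) + j + 1 + γ + l)
    set A := Real.Gamma (((j + d : ℕ) : ℝ) + 1 + l)
    set B := Real.Gamma (((j + d : ℕ) : ℝ) + 1 + γ + l)
    set R := x.1 ^ 2 + x.2 ^ 2
    have e6 : ((-1 : ℝ) ^ (j + d) * (A / ((j + d).factorial * B)) * ((-1) ^ j * (2 ^ j)⁻¹ *
        ((j + d).factorial / (j.factorial * d.factorial)) * (G / (l + j).factorial) *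
          (2 ^ j * R ^ j))) = ((-1) ^ (j + d) * (-1) ^ j) * (A / B) * G /
            (j.factorial * d.factorial * (l + j).factorial) * R ^ j := by
      have f3' : ((j + d).factorial : ℝ) ≠ 0 := by exact_mod_cast (j + d).factorial_ne_zero
      have f5 : (2 : ℝ) ^ j ≠ 0 := by positivity
      field_simp
    rw [e6]
    push_cast
    rw [hsgn]
    calc _ = ((-1) ^ d * (A / B : ℂ) * G / (j.factorial * d.factorial * (l + j).factorial)) *
          (zvar 1 x ^ l * (R : ℂ) ^ j) := by ring
      _ = _ := by
          rw [hpow]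
          field_simp
  rw [diskPoly_eq_sum_range 1 γ (N := n + 1) (by simp), ← Finset.sum_range_reflect, Finset.mul_sum,
    jacobiP, Finset.mul_sum, Complex.ofReal_sum, Finset.mul_sum]
  refine Finset.sum_congr rfl fun j hj => ?_
  rw [show n + 1 - 1 - j = n - j by omega]
  exact hterm j hj

/-- The real part of `z` for `μ = 1` and the imaginary part for `μ = -1`. -/
noncomputable def partL (μ : ℤˣ) : ℂ →L[ℝ] ℝ := if μ = 1 then Complex.reCLM else Complex.imCLM

lemma exists_basisFun_eq {γ : ℝ} (hγ : 0 ≤ γ) (i : BasisIndex) :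
    ∃ c : ℝ, c ≠ 0 ∧ ∀ x, basisFun γ i x = c * partL i.μ (diskPoly 1 γ (i.n + i.l) i.n x) := by
  obtain ⟨l, n, μ, h0⟩ := i
  simp only at h0 ⊢
  set κ := Real.Gamma (n + 1 + l) / Real.Gamma (n + 1 + γ + l) with hκ
  have hκ0 : κ ≠ 0 :=
    (div_pos (Real.Gamma_pos_of_pos (by positivity)) (Real.Gamma_pos_of_pos (by positivity))).ne'
  have key := zvar_pow_mul_jacobiP γ n l
  rw [← hκ] at key
  have hre : ∀ x, (zvar 1 x ^ l).re * jacobiP n γ l (2 * (x.1 ^ 2 + x.2 ^ 2) - 1) =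
      κ * (diskPoly 1 γ (n + l) n x).re := by
    intro x
    rw [← Complex.re_mul_ofReal, key, Complex.re_ofReal_mul]
  have him : ∀ x, (zvar 1 x ^ l).im * jacobiP n γ l (2 * (x.1 ^ 2 + x.2 ^ 2) - 1) =
      κ * (diskPoly 1 γ (n + l) n x).im := by
    intro x
    rw [← Complex.im_mul_ofReal, key, Complex.im_ofReal_mul]
  rcases eq_or_ne μ 1 with rfl | hμ
  · rcases eq_or_ne l 0 with rfl | hl
    · refine ⟨1 / 2 * κ, by positivity, fun x => ?_⟩
      have := hre x
      simp only [pow_zero, Complex.one_re, one_mul] at this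
      simp only [basisFun, solidHarmonic, partL, if_true, this, Complex.reCLM_apply]
      ring
    · refine ⟨κ, hκ0, fun x => ?_⟩
      simp only [basisFun, solidHarmonic, partL, if_true, if_neg hl, ← zvar_one, hre x,
        Complex.reCLM_apply]
  · refine ⟨κ, hκ0, fun x => ?_⟩
    simp only [basisFun, solidHarmonic, partL, if_neg hμ, ← zvar_one, him x, Complex.imCLM_apply]

/-- The summands of the series do not depend on the normalization of the basis functions. -/
lemma coeff_sq_mul_wNorm_sq {γ : ℝ} (u : ℝ × ℝ → ℝ) (i : BasisIndex) {R : ℝ × ℝ → ℝ} {c : ℝ}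
    (hc : c ≠ 0) (h : ∀ x, basisFun γ i x = c * R x) :
    coeff γ u i ^ 2 * wNorm γ (basisFun γ i) ^ 2 =
      (∫ x, u x * R x ∂(diskMeasure γ)) ^ 2 / ∫ x, R x ^ 2 ∂(diskMeasure γ) := by
  have h1 : wNorm γ (basisFun γ i) ^ 2 = c ^ 2 * ∫ x, R x ^ 2 ∂(diskMeasure γ) := by
    rw [wNorm_sq, ← integral_const_mul]
    congr 1; ext x; rw [h]; ring
  have h2 : wInner γ u (basisFun γ i) = c * ∫ x, u x * R x ∂(diskMeasure γ) := by
    rw [wInner, ← integral_const_mul]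
    congr 1; ext x; rw [h]; ring
  rw [coeff, h1, h2]
  rcases eq_or_ne (∫ x, R x ^ 2 ∂(diskMeasure γ)) 0 with h0 | h0
  · simp [h0]
  · field_simp

/-- The bidegree of the disk polynomial whose real or imaginary part is the basis function: the
indices `(l, n, 1)` and `(l, n, -1)` correspond to a disk polynomial and its conjugate. -/
noncomputable def bidegree : BasisIndex ≃ ℕ × ℕ where
  toFun i := if i.μ = 1 then (i.n + i.l, i.n) else (i.n, i.n + i.l)
  invFun k := if h : k.2 ≤ k.1 then ⟨k.1 - k.2, k.2, 1, fun _ => rfl⟩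
    else ⟨k.2 - k.1, k.1, -1, fun h0 => absurd (Nat.sub_eq_zero_iff_le.1 h0) h⟩
  left_inv := by
    rintro ⟨l, n, μ, h0⟩
    rcases Int.units_eq_one_or μ with rfl | rfl
    · simp
    · have hl : ¬ l = 0 := fun h => by simpa using h0 h
      have : ¬ n + l ≤ n := by omega
      simp [this]
  right_inv := by
    rintro ⟨P, Q⟩
    by_cases h : Q ≤ P
    · simp [h]
    · have : P ≤ Q := by omega
      simp [h, this]

lemma two_mul_add_eq (i : BasisIndex) : 2 * i.n + i.l = (bidegree i).1 + (bidegree i).2 := by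
  simp only [bidegree, Equiv.coe_fn_mk]
  split_ifs <;> simp <;> omega

/-- The involution that exchanges the indices `(l, n, 1)` and `(l, n, -1)` for `l ≥ 1`. -/
noncomputable def flipIndex (i : BasisIndex) : BasisIndex :=
  if h : i.l = 0 then i else ⟨i.l, i.n, -i.μ, fun h0 => absurd h0 h⟩

@[simp] lemma flipIndex_l (i : BasisIndex) : (flipIndex i).l = i.l := by
  unfold flipIndex; split_ifs <;> rfl

@[simp] lemma flipIndex_n (i : BasisIndex) : (flipIndex i).n = i.n := by
  unfold flipIndex; split_ifs <;> rfl

lemma flipIndex_involutive : Function.Involutive flipIndex := by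
  rintro ⟨l, n, μ, h0⟩
  by_cases h : l = 0 <;> simp [flipIndex, h]

lemma dpTerm_swap (γ : ℝ) (u : ℝ × ℝ → ℝ) (P Q : ℕ) : dpTerm γ u (P, Q) = dpTerm γ u (Q, P) := by
  unfold dpTerm
  simp only
  rw [dpNormSq_comm γ P Q]
  congr 2
  rw [← RCLike.norm_conj, ← integral_conj]
  simp only [map_mul, Complex.conj_ofReal, conj_diskPoly]

/-- The two basis functions belonging to a pair of conjugate disk polynomials contribute as much as
these two polynomials. -/
lemma coeffTerm_add_flip {γ : ℝ} (hγ : 0 ≤ γ) (s : ℕ) {u : ℝ × ℝ → ℝ} (hu : MemL2 γ u)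
    (i : BasisIndex) :
    coeffTerm γ s u i + coeffTerm γ s u (flipIndex i) =
      2 * (((i.n : ℝ) + 1) ^ s * ((i.n : ℝ) + i.l + 1) ^ s * dpTerm γ u (i.n + i.l, i.n)) := by
  have hfin := isFiniteMeasure_diskMeasure hγ
  set Z := diskPoly 1 γ (i.n + i.l) i.n with hZ
  have hc : Continuous Z := (contDiff_diskPoly _ _ _ _).continuous
  -- the integrals of the real and imaginary parts
  have hui : Integrable (fun x => (u x : ℂ) * Z x) (diskMeasure γ) := by
    obtain ⟨M, -, hM⟩ := exists_bound_on_disk hc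
    have huc : MemLp (fun x => (u x : ℂ)) 2 (diskMeasure γ) := MemLp.ofReal hu
    exact (huc.integrable (by norm_num)).mul_bdd (c := M) hc.aestronglyMeasurable
      ((ae_diskMeasure_mem γ).mono fun x hx => hM x hx)
  have hx : ∀ L : ℂ →L[ℝ] ℝ, ∫ x, u x * L (Z x) ∂(diskMeasure γ) =
      L (∫ x, (u x : ℂ) * Z x ∂(diskMeasure γ)) := by
    intro L
    rw [← L.integral_comp_comm hui]
    congr 1; ext x
    rw [← Complex.real_smul, map_smul, smul_eq_mul]
  have hint : ∀ L : ℂ →L[ℝ] ℝ, Integrable (fun x => L (Z x) ^ 2) (diskMeasure γ) := by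
    intro L
    have h1 : Continuous fun x => ((L (Z x) ^ 2 : ℝ) : ℂ) := by fun_prop
    have h2 : Integrable (fun x => RCLike.re ((L (Z x) ^ 2 : ℝ) : ℂ)) (diskMeasure γ) :=
      (integrable_of_continuous hγ h1).re
    simpa only [RCLike.re_to_complex, Complex.ofReal_re] using h2
  have hsum : (∫ x, Complex.reCLM (Z x) ^ 2 ∂(diskMeasure γ)) +
      ∫ x, Complex.imCLM (Z x) ^ 2 ∂(diskMeasure γ) = dpNormSq γ (i.n + i.l) i.n := by
    rw [← integral_add (hint _) (hint _), dpNormSq]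
    congr 1; ext x
    rw [← Complex.normSq_eq_norm_sq, Complex.normSq_apply, Complex.reCLM_apply,
      Complex.imCLM_apply, hZ]
    ring
  have hterm : ∀ j : BasisIndex, j.l = i.l → j.n = i.n → coeffTerm γ s u j =
      ((i.n : ℝ) + 1) ^ s * ((i.n : ℝ) + i.l + 1) ^ s *
        ((partL j.μ (∫ x, (u x : ℂ) * Z x ∂(diskMeasure γ))) ^ 2 /
          ∫ x, partL j.μ (Z x) ^ 2 ∂(diskMeasure γ)) := by
    intro j hl hn
    obtain ⟨c, hc0, hcb⟩ := exists_basisFun_eq hγ j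
    rw [coeffTerm, mul_assoc, coeff_sq_mul_wNorm_sq u j hc0 hcb, hl, hn, hx]
  set I := ∫ x, (u x : ℂ) * Z x ∂(diskMeasure γ) with hI
  have hdp : dpTerm γ u (i.n + i.l, i.n) = (I.re ^ 2 + I.im ^ 2) / dpNormSq γ (i.n + i.l) i.n := by
    rw [dpTerm, ← Complex.normSq_eq_norm_sq, Complex.normSq_apply]
    simp only [hI, hZ]
    ring
  have hpos := dpNormSq_pos hγ (i.n + i.l) i.n
  rw [hterm i rfl rfl, hterm (flipIndex i) (flipIndex_l i) (flipIndex_n i), hdp]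
  by_cases hl : i.l = 0
  · -- for `l = 0` the disk polynomial is real
    have hZr : ∀ x, (Z x).im = 0 := by
      intro x
      rw [← Complex.conj_eq_iff_im, hZ, conj_diskPoly, hl, add_zero]
    have hIr : I.im = 0 := by
      have := hx Complex.imCLM
      simpa [hZr] using this.symm
    have hN : ∫ x, Complex.reCLM (Z x) ^ 2 ∂(diskMeasure γ) = dpNormSq γ (i.n + i.l) i.n := by
      rw [← hsum]
      simp [hZr]
    have hf : flipIndex i = i := by simp [flipIndex, hl]
    simp only [Complex.reCLM_apply] at hN
    rw [hf]
    simp only [partL, i.zero_imp hl, if_true, hN, hIr, Complex.reCLM_apply]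
    ring
  · -- for `l ≥ 1` the integral of `Z²` vanishes, so both parts of `Z` have the same norm
    have hsq : ∫ x, Z x * Z x ∂(diskMeasure γ) = 0 :=
      integral_diskPoly_mul_eq_zero hγ _ _ _ _ (by simp; omega)
    have hdiff : (∫ x, Complex.reCLM (Z x) ^ 2 ∂(diskMeasure γ)) -
        ∫ x, Complex.imCLM (Z x) ^ 2 ∂(diskMeasure γ) = 0 := by
      rw [← integral_sub (hint _) (hint _)]
      have h1 := Complex.reCLM.integral_comp_comm (integrable_of_continuous hγ (hc.mul hc))
      simp only [Pi.mul_apply] at h1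
      rw [hsq, map_zero] at h1
      rw [← h1]
      congr 1; ext x
      simp only [Complex.reCLM_apply, Complex.imCLM_apply, Complex.mul_re]
      ring
    have hN1 : ∫ x, Complex.reCLM (Z x) ^ 2 ∂(diskMeasure γ) =
        dpNormSq γ (i.n + i.l) i.n / 2 := by linarith
    have hN2 : ∫ x, Complex.imCLM (Z x) ^ 2 ∂(diskMeasure γ) =
        dpNormSq γ (i.n + i.l) i.n / 2 := by linarith
    simp only [Complex.reCLM_apply, Complex.imCLM_apply] at hN1 hN2
    have hf : (flipIndex i).μ = -i.μ := by simp [flipIndex, hl]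
    have hm : ¬ (-1 : ℤˣ) = 1 := by decide
    rw [hf]
    rcases Int.units_eq_one_or i.μ with hμ | hμ <;> rw [hμ] <;>
      simp only [partL, if_true, if_neg hm, neg_neg, hN1, hN2, Complex.reCLM_apply,
        Complex.imCLM_apply] <;> [field_simp; (field_simp; ring)]

lemma coeffTerm_nonneg (γ : ℝ) (s : ℕ) (u : ℝ × ℝ → ℝ) (i : BasisIndex) :
    0 ≤ coeffTerm γ s u i := by
  unfold coeffTerm; positivity

lemma dpTerm_nonneg {γ : ℝ} (hγ : 0 ≤ γ) (u : ℝ × ℝ → ℝ) (i : ℕ × ℕ) : 0 ≤ dpTerm γ u i :=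
  div_nonneg (by positivity) (dpNormSq_pos hγ _ _).le

/-- The weighted contributions of the disk polynomials of degree at least `s`. -/
noncomputable def highTerm (γ : ℝ) (s : ℕ) (u : ℝ × ℝ → ℝ) (i : ℕ × ℕ) : ℝ :=
  if s ≤ i.1 + i.2 then ((i.1 : ℝ) + 1) ^ s * ((i.2 : ℝ) + 1) ^ s * dpTerm γ u i else 0

lemma highTerm_nonneg {γ : ℝ} (hγ : 0 ≤ γ) (s : ℕ) (u : ℝ × ℝ → ℝ) (i : ℕ × ℕ) :
    0 ≤ highTerm γ s u i := by
  have := dpTerm_nonneg hγ u i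
  unfold highTerm; split_ifs <;> positivity

/-- Two series whose terms agree after symmetrization under a permutation have the same sum. -/
lemma hasSum_of_add_perm {ι : Type*} (e : Equiv.Perm ι) {F G : ι → ℝ} (hF : ∀ i, 0 ≤ F i)
    (hG : Summable G) (h : ∀ i, F i + F (e i) = G i + G (e i)) : HasSum F (∑' i, G i) := by
  have hGe : Summable fun i => G (e i) := e.summable_iff.2 hG
  have hFs : Summable F := Summable.of_nonneg_of_le hF
    (fun i => by have := h i; have := hF (e i); linarith) (hG.add hGe)
  have hFe : Summable fun i => F (e i) := e.summable_iff.2 hFs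
  have h1 := hFs.tsum_add hFe
  simp only [h] at h1
  rw [hG.tsum_add hGe, e.tsum_eq F, e.tsum_eq G] at h1
  have h2 : ∑' i, F i = ∑' i, G i := by linarith
  exact h2 ▸ hFs.hasSum

lemma highTerm_bidegree (γ : ℝ) (s : ℕ) (u : ℝ × ℝ → ℝ) (i : BasisIndex) :
    highTerm γ s u (bidegree i) = if s ≤ 2 * i.n + i.l then
      ((i.n : ℝ) + 1) ^ s * ((i.n : ℝ) + i.l + 1) ^ s * dpTerm γ u (i.n + i.l, i.n) else 0 := by
  unfold highTerm
  rw [two_mul_add_eq]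
  split_ifs with h
  · simp only [bidegree, Equiv.coe_fn_mk]
    split_ifs
    · push_cast; ring
    · rw [dpTerm_swap]; push_cast; ring
  · rfl

/-- The series over the real basis functions and the series over the disk polynomials agree. -/
lemma hasSum_coeffTerm {γ : ℝ} (hγ : 0 ≤ γ) (s : ℕ) {u : ℝ × ℝ → ℝ} (hu : MemL2 γ u)
    (hsum : Summable (highTerm γ s u)) :
    HasSum (fun i : {i : BasisIndex // s ≤ 2 * i.n + i.l} => coeffTerm γ s u i)
      (∑' k, highTerm γ s u k) := by
  have hG : Summable fun i => highTerm γ s u (bidegree i) := (bidegree.summable_iff (f := highTerm γ s u)).2 hsum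
  have key := hasSum_of_add_perm flipIndex_involutive.toPerm
    (F := {i : BasisIndex | s ≤ 2 * i.n + i.l}.indicator (coeffTerm γ s u))
    (fun i => Set.indicator_nonneg (fun i _ => coeffTerm_nonneg γ s u i) i) hG (fun i => by
      simp only [Set.indicator_apply, Set.mem_ofPred_eq, highTerm_bidegree,
        Function.Involutive.coe_toPerm, flipIndex_l, flipIndex_n]
      split_ifs
      · rw [coeffTerm_add_flip hγ s hu i]
        ring
      · rfl)
  rw [bidegree.tsum_eq (highTerm γ s u)] at key
  exact (hasSum_subtype_iff_indicator (s := {i : BasisIndex | s ≤ 2 * i.n + i.l})).2 key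

end WeightedDisk

theorem mainTheorem2 (γ : ℝ) (hγ : 0 ≤ γ) (s : ℕ) :
    ∃ C₀ C₁ : ℝ, 0 < C₀ ∧ 0 < C₁ ∧
      ∀ u : ℝ × ℝ → ℝ, WeightedDisk.MemSobolev γ s u →
        Summable (fun i : {i : WeightedDisk.BasisIndex // s ≤ 2 * i.n + i.l} =>
          WeightedDisk.coeffTerm γ s u i) ∧
        C₀ * ∑' i : {i : WeightedDisk.BasisIndex // s ≤ 2 * i.n + i.l},
            WeightedDisk.coeffTerm γ s u i ≤ WeightedDisk.sobolevSeminorm γ s u ^ 2 ∧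
        WeightedDisk.sobolevSeminorm γ s u ^ 2 ≤
          C₁ * ∑' i : {i : WeightedDisk.BasisIndex // s ≤ 2 * i.n + i.l},
            WeightedDisk.coeffTerm γ s u i := by
  have hA : 0 < ((s : ℝ) + 1) ^ s * ((s : ℝ) + 1) ^ s := by positivity
  set A := ((s : ℝ) + 1) ^ s * ((s : ℝ) + 1) ^ s with hAdef
  set D := (∑ k ∈ Finset.HasAntidiagonal.antidiagonal s, (s.choose k.1 : ℝ)) * (1 + γ + s) ^ s
    with hD
  have hD0 : 0 ≤ D := by positivity
  refine ⟨2 ^ s / A, 2 ^ s * (D + 1), by positivity, by positivity, fun u hu => ?_⟩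
  have hsum := WeightedDisk.hasSum_sobolevSeminorm hγ hu
  have hdp := WeightedDisk.dpTerm_nonneg hγ u
  have hlow : ∀ i, 2 ^ s / A * WeightedDisk.highTerm γ s u i ≤
      2 ^ s * (WeightedDisk.lamSum γ s i * WeightedDisk.dpTerm γ u i) := by
    intro i
    unfold WeightedDisk.highTerm
    split_ifs with h
    · have h1 := mul_le_mul_of_nonneg_right (WeightedDisk.le_lamSum hγ h) (hdp i)
      rw [← hAdef] at h1
      have h2 := mul_le_mul_of_nonneg_left h1 (pow_nonneg zero_le_two s : (0 : ℝ) ≤ 2 ^ s)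
      rw [div_mul_eq_mul_div, div_le_iff₀ hA]
      linarith
    · rw [WeightedDisk.lamSum_eq_zero (not_le.1 h)]
      simp
  have hup : ∀ i, 2 ^ s * (WeightedDisk.lamSum γ s i * WeightedDisk.dpTerm γ u i) ≤
      2 ^ s * (D + 1) * WeightedDisk.highTerm γ s u i := by
    intro i
    rw [mul_assoc]
    refine mul_le_mul_of_nonneg_left ?_ (by positivity)
    unfold WeightedDisk.highTerm
    split_ifs with h
    · rw [← mul_assoc]
      refine mul_le_mul_of_nonneg_right ?_ (hdp i)
      refine (WeightedDisk.lamSum_le hγ s i).trans ?_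
      exact mul_le_mul_of_nonneg_right (by linarith) (by positivity)
    · rw [WeightedDisk.lamSum_eq_zero (not_le.1 h)]
      simp
  have hh : Summable (WeightedDisk.highTerm γ s u) := by
    have h1 : Summable fun i => 2 ^ s / A * WeightedDisk.highTerm γ s u i :=
      Summable.of_nonneg_of_le
        (fun i => mul_nonneg (by positivity) (WeightedDisk.highTerm_nonneg hγ s u i)) hlow
        hsum.summable
    exact (summable_mul_left_iff (by positivity)).1 h1
  have hS := WeightedDisk.hasSum_coeffTerm hγ s hu.1 hh
  refine ⟨hS.summable, ?_, ?_⟩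
  · rw [hS.tsum_eq]
    exact hasSum_le hlow (hh.hasSum.mul_left _) hsum
  · rw [hS.tsum_eq]
    exact hasSum_le hup hsum (hh.hasSum.mul_left _)
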